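/- Consider a block Rayleigh fading channel with unit-variance complex Gaussian noise, in which the signal space is divided into coherence subspaces of dimension $N_c$. On each subspace the channel acts as multiplication by one coefficient $h\sim\mathcal{CN}(0,1)$, and the coefficients of different subspaces are independent. The average transmit energy per dimension is $\mathrm{SNR}$. In the training-based scheme a fraction $\eta\in[0,1]$ of the energy $N_c\,\mathrm{SNR}$ of a subspace is spent on one training dimension, in which the receiver observes $y_0=\sqrt{\eta N_c\mathrm{SNR}}\,h+w_0$ and forms the MMSE estimate $\hat h=\mathbb E[h\mid y_0]$. Each of the other $N_c-1$ dimensions carries a data symbol $x\sim\mathcal{CN}(0,1)$, received as $y=\sqrt{\rho}\,h\,x+w$ with $\rho=(1-\eta)N_c\,\mathrm{SNR}/(N_c-1)$ and $w\sim\mathcal{CN}(0,1)$, and is detected coherently, symbol by symbol, from $y$ and $\hat h$; here $h,w_0,x,w$ are independent. The average mutual information per dimension (in bits) of the scheme, with the energy split optimized, is $$I_{tr}(\mathrm{SNR})=\sup_{0\le\eta\le1}\frac{N_c-1}{N_c}\,I\big(x;\,(y,\hat h)\big).$$ Let $C_{coh}(\mathrm{SNR})=\mathbb E\big[\log_2(1+\mathrm{SNR}\,|h|^2)\big]$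 be the coherent capacity. A spectral efficiency $R(\mathrm{SNR})$ is called first-order optimal if it has the same limiting energy per bit $\frac{E_b}{N_0}_{\min}=\lim_{\mathrm{SNR}\downarrow0}\mathrm{SNR}/R(\mathrm{SNR})$ as $C_{coh}$. It is called second-order optimal if, in addition, it has the same wideband slope $$S_0=\lim_{\mathrm{SNR}\downarrow0}\frac{R(\mathrm{SNR})}{10\log_{10}\frac{\mathrm{SNR}}{R(\mathrm{SNR})}-10\log_{10}\frac{E_b}{N_0}_{\min}}\cdot 10\log_{10}2$$ as $C_{coh}$. Let $k>0$, $\mu>0$ and let the coherence dimension scale as $N_c=k/\mathrm{SNR}^{\mu}$. Then, as $\mathrm{SNR}\downarrow0$, $$I_{tr}\ \ge\ \log_2(e)\left[\mathrm{SNR}-\mathrm{SNR}^2-O\!\left(\mathrm{SNR}^{\frac{1+\mu}{2}}\right)\right],$$ with a constant depending only on $k$ and $\mu$; in particular $I_{tr}\ge\log_2(e)\big[\mathrm{SNR}-O(\mathrm{SNR}^{(1+\mu)/2})\big]$ if $\mu\le3$. Moreover, the scheme is first-order optimal if and only if $\mu>1$, and second-order optimal if and only if $\mu>3$. -/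

import Mathlib

open MeasureTheory ProbabilityTheory Filter Topology

noncomputable section

namespace TrainingSTF

/-- The circularly symmetric complex Gaussian law `CN(0,1)`: real and imaginary parts are
independent centred Gaussians of variance `1/2`, so that `E|z|² = 1`. -/
def stdCN : Measure ℂ :=
  ((gaussianReal 0 (1 / 2)).prod (gaussianReal 0 (1 / 2))).map
    (fun p : ℝ × ℝ => (⟨p.1, p.2⟩ : ℂ))

/-- Mutual information (in nats) of two random variables: the relative entropy of their joint
law with respect to the product of their marginal laws. -/
def mutualInfo {Ω α β : Type*} [MeasurableSpace Ω] [MeasurableSpace α] [MeasurableSpace β]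
    (P : Measure Ω) (X : Ω → α) (Y : Ω → β) : ENNReal :=
  InformationTheory.klDiv (P.map (fun ω => (X ω, Y ω))) ((P.map X).prod (P.map Y))

/-- The randomness seen by one data dimension of a coherence subspace: `(h, w₀, x, w)`, where
`h` is the fading coefficient of the subspace, `w₀` the noise in its training dimension,
`x` the data symbol and `w` the noise in the data dimension. -/
abbrev Sample : Type := ℂ × ℂ × ℂ × ℂ

/-- `h`, `w₀`, `x`, `w` are i.i.d. `CN(0,1)`: Rayleigh fading, white Gaussian noise and
(non-peaky) Gaussian signalling. -/
def sampleLaw : Measure Sample := stdCN.prod (stdCN.prod (stdCN.prod stdCN))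

/-- The fading coefficient. -/
def fading (ω : Sample) : ℂ := ω.1

/-- The unit-energy data symbol. -/
def dataSymbol (ω : Sample) : ℂ := ω.2.2.1

/-- Received symbol in the training dimension, training energy `E`. -/
def trainObs (E : ℝ) (ω : Sample) : ℂ := (Real.sqrt E : ℂ) * ω.1 + ω.2.1

/-- Received symbol in a data dimension, energy `ρ` per data symbol. -/
def dataObs (ρ : ℝ) (ω : Sample) : ℂ := (Real.sqrt ρ : ℂ) * ω.1 * ω.2.2.1 + ω.2.2.2

/-- The MMSE estimate of the fading coefficient from the training observation: its conditional
expectation given that observation. -/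
def mmseEstimate (E : ℝ) : Sample → ℂ :=
  condExp (MeasurableSpace.comap (trainObs E) inferInstance) sampleLaw fading

/-- Average mutual information, in bits per signal space dimension, for coherence dimension `Nc`,
signal-to-noise ratio `snr` and training energy fraction `η`. The energy of a coherence subspace
is `Nc * snr`. One dimension carries training, with energy `η * Nc * snr`; each of the remaining
`Nc - 1` dimensions has energy `(1 - η) * Nc * snr / (Nc - 1)` and contributes the mutual
information between its data symbol and what the coherent detector is given for that symbol,
namely the received symbol and the channel estimate. -/
def trainingRate (Nc snr η : ℝ) : ℝ :=
  (Nc - 1) / Nc *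
    ((mutualInfo sampleLaw dataSymbol
        (fun ω => (dataObs ((1 - η) * Nc * snr / (Nc - 1)) ω,
          mmseEstimate (η * Nc * snr) ω))).toReal / Real.log 2)

/-- Average mutual information of the training-based scheme with coherence dimension
`Nc = k / snr ^ μ` and the best split of the energy between training and data. -/
def avgMutualInfo (k μ snr : ℝ) : ℝ :=
  ⨆ η : Set.Icc (0 : ℝ) 1, trainingRate (k / snr ^ μ) snr η

/-- Coherent ergodic capacity of the Rayleigh fading channel, in bits per dimension. -/
def coherentCapacity (snr : ℝ) : ℝ :=
  ∫ h, Real.logb 2 (1 + snr * ‖h‖ ^ 2) ∂stdCN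

/-- The spectral efficiency `R` (bits per dimension as a function of the signal-to-noise ratio)
has energy per bit `snr / R snr` tending to `e` in the wideband limit. -/
def HasEbN0 (R : ℝ → ℝ) (e : ℝ) : Prop :=
  Tendsto (fun snr => snr / R snr) (𝓝[>] 0) (𝓝 e)

/-- `R`, whose limiting energy per bit is `e`, has wideband slope `S` (bits per dimension
per 3 dB): the slope of the spectral efficiency against the energy per bit in decibels. -/
def HasWidebandSlope (R : ℝ → ℝ) (e S : ℝ) : Prop :=
  Tendsto (fun snr => R snr / (10 * Real.logb 10 (snr / R snr) - 10 * Real.logb 10 e)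
    * (10 * Real.logb 10 2)) (𝓝[>] 0) (𝓝 S)

/-- `R` achieves the minimum energy per bit of the capacity `C`. -/
def FirstOrderOptimal (C R : ℝ → ℝ) : Prop :=
  ∃ e : ℝ, HasEbN0 C e ∧ HasEbN0 R e

/-- `R` achieves both the minimum energy per bit and the wideband slope of the capacity `C`. -/
def SecondOrderOptimal (C R : ℝ → ℝ) : Prop :=
  ∃ e S : ℝ, HasEbN0 C e ∧ HasEbN0 R e ∧ HasWidebandSlope C e S ∧ HasWidebandSlope R e S

end TrainingSTF

end

/-!
Training with energy `E = η * Nc * snr` splits the fading coefficient into independent parts: an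
estimate `CN(0, v)` with `v = E / (1 + E)` and an error `CN(0, s)` with `s = 1 / (1 + E)`. Given
the symbol `x` and the estimate `c`, the received symbol is therefore `CN(√ρ c x, 1 + ρ s |x|²)`.

Its mutual information with `x` is bounded below by the information that a mismatched detector
extracts when it takes the error contribution for Gaussian noise of variance `ρ s`, and above by
the average divergence from `CN(0, 1 + ρ (s + |c|²))`, the Gaussian law of the same variance given
`c`. Expanding the logarithms, both bounds are `v ρ - ρ²` up to terms of order `s ρ² + ρ³`.

Summing over the data dimensions and writing `t = √(Nc * snr)`, the best split loses, against the
`snr - snr² + O(snr³)` of coherent reception, at least `snr / (2 * (1 + t))` and at most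
`4 * snr / t`. With `Nc = k / snr ^ μ` both are of order `snr ^ ((1 + μ) / 2)` as long as `μ ≥ 1`.
This loss is `o(snr)`, which decides the energy per bit, exactly when `μ > 1`, and `o(snr²)`, which
decides the wideband slope, exactly when `μ > 3`.
-/

namespace TrainingSTF

section KullbackLeibler

open InformationTheory

variable {α : Type*} [MeasurableSpace α] {μ ν : Measure α}

lemma lintegral_div_rnDeriv_le [SigmaFinite μ] [SigmaFinite ν] (hac : μ ≪ ν) {g : α → ℝ}
    (hg : Measurable g) :
    ∫⁻ a, ENNReal.ofReal (g a / (μ.rnDeriv ν a).toReal) ∂μ ≤ ∫⁻ a, ENNReal.ofReal (g a) ∂ν := by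
  rw [← lintegral_rnDeriv_mul hac (by fun_prop)]
  refine lintegral_mono_ae ?_
  filter_upwards [μ.rnDeriv_lt_top ν] with a ha
  obtain h0 | h0 := eq_or_ne (μ.rnDeriv ν a) 0
  · simp [h0]
  · rw [ENNReal.ofReal_div_of_pos (ENNReal.toReal_pos h0 ha.ne), ENNReal.ofReal_toReal ha.ne,
      ENNReal.mul_div_cancel h0 ha.ne]

variable [IsProbabilityMeasure μ] [IsProbabilityMeasure ν]

-- The easy half of the Donsker–Varadhan variational formula.
lemma integral_log_le_toReal_klDiv (hfin : klDiv μ ν ≠ ⊤) {g : α → ℝ} (hgm : Measurable g)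
    (hg : ∀ a, 0 < g a) (hg1 : ∫⁻ a, ENNReal.ofReal (g a) ∂ν ≤ 1)
    (hlog : Integrable (fun a => Real.log (g a)) μ) :
    ∫ a, Real.log (g a) ∂μ ≤ (klDiv μ ν).toReal := by
  obtain ⟨hac, hllr⟩ := klDiv_ne_top_iff.1 hfin
  set W : α → ℝ := fun a => g a / (μ.rnDeriv ν a).toReal
  have hW0 : ∀ a, 0 ≤ W a := fun a => div_nonneg (hg a).le ENNReal.toReal_nonneg
  have hWm : Measurable W := by fun_prop
  have hW1 : ∫⁻ a, ENNReal.ofReal (W a) ∂μ ≤ 1 := (lintegral_div_rnDeriv_le hac hgm).trans hg1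
  have hWint : Integrable W μ := by
    refine ⟨hWm.aestronglyMeasurable, ?_⟩
    rw [hasFiniteIntegral_iff_ofReal (ae_of_all _ hW0)]
    exact hW1.trans_lt ENNReal.one_lt_top
  have hWle : ∫ a, W a ∂μ ≤ 1 := by
    rw [integral_eq_lintegral_of_nonneg_ae (ae_of_all _ hW0) hWm.aestronglyMeasurable]
    exact ENNReal.toReal_le_of_le_ofReal zero_le_one (by simpa using hW1)
  have hWsub : Integrable (fun a => W a - 1) μ := hWint.sub (integrable_const 1)
  have hpt : ∀ᵐ a ∂μ, Real.log (g a) ≤ llr μ ν a + (W a - 1) := by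
    filter_upwards [Measure.rnDeriv_pos hac, hac.ae_le (μ.rnDeriv_lt_top ν)] with a h0 htop
    have hd := ENNReal.toReal_pos h0.ne' htop.ne
    have := Real.log_le_sub_one_of_pos (div_pos (hg a) hd)
    rw [Real.log_div (hg a).ne' hd.ne'] at this
    simp only [llr, W]
    linarith
  calc ∫ a, Real.log (g a) ∂μ ≤ ∫ a, (llr μ ν a + (W a - 1)) ∂μ :=
        integral_mono_ae hlog (hllr.add hWsub) hpt
    _ = (klDiv μ ν).toReal + (∫ a, W a ∂μ - 1) := by
        rw [integral_add hllr hWsub, integral_sub hWint (integrable_const 1), integral_const,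
          probReal_univ, one_smul, toReal_klDiv_of_measure_eq hac (by simp)]
    _ ≤ (klDiv μ ν).toReal := by linarith

lemma klDiv_withDensity {lam : Measure α} [SigmaFinite lam] {p r : α → ℝ}
    (hpm : Measurable p) (hp : ∀ a, 0 < p a) (hrm : Measurable r) (hr : ∀ a, 0 < r a)
    (hμ : μ = lam.withDensity fun a => ENNReal.ofReal (p a))
    (hν : ν = lam.withDensity fun a => ENNReal.ofReal (r a))
    (hlogp : Integrable (fun a => Real.log (p a)) μ)
    (hlogr : Integrable (fun a => Real.log (r a)) μ) :
    klDiv μ ν ≠ ⊤ ∧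
      (klDiv μ ν).toReal = ∫ a, Real.log (p a) ∂μ - ∫ a, Real.log (r a) ∂μ := by
  have hdens : μ = ν.withDensity fun a => ENNReal.ofReal (p a / r a) := by
    rw [hν, ← withDensity_mul _ (by fun_prop) (by fun_prop), hμ]
    congr 1
    funext a
    rw [Pi.mul_apply, ← ENNReal.ofReal_mul (hr a).le, mul_div_cancel₀ _ (hr a).ne']
  have hac : μ ≪ ν := hdens ▸ withDensity_absolutelyContinuous _ _
  have hrn : μ.rnDeriv ν =ᵐ[ν] fun a => ENNReal.ofReal (p a / r a) := by
    conv_lhs => rw [hdens]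
    exact Measure.rnDeriv_withDensity _ (by fun_prop)
  have hllr : llr μ ν =ᵐ[μ] fun a => Real.log (p a) - Real.log (r a) := by
    filter_upwards [hac.ae_le hrn] with a ha
    rw [llr, ha, ENNReal.toReal_ofReal (div_pos (hp a) (hr a)).le,
      Real.log_div (hp a).ne' (hr a).ne']
  refine ⟨klDiv_ne_top hac ((hlogp.sub hlogr).congr hllr.symm), ?_⟩
  rw [toReal_klDiv_of_measure_eq hac (by simp), integral_congr_ae hllr, integral_sub hlogp hlogr]

variable {X Y : Type*} [MeasurableSpace X] [MeasurableSpace Y]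

lemma klDiv_map_swap {μ ν : Measure (X × Y)} [IsFiniteMeasure μ] [IsFiniteMeasure ν] :
    klDiv (μ.map Prod.swap) (ν.map Prod.swap) = klDiv μ ν := by
  refine (klDiv_map_le _ _ measurable_swap).antisymm ?_
  simpa [Measure.map_map measurable_swap measurable_swap] using
    klDiv_map_le (μ.map Prod.swap) (ν.map Prod.swap) measurable_swap

lemma klDiv_prod_marginals_le [StandardBorelSpace X] [Nonempty X] (P : Measure (X × Y))
    [IsProbabilityMeasure P] (ρ : Measure Y) [IsProbabilityMeasure ρ] :
    klDiv P (P.fst.prod P.snd) ≤ klDiv P (P.fst.prod ρ) := by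
  have hswap : ∀ ν : Measure Y, [IsProbabilityMeasure ν] → klDiv P (P.fst.prod ν) =
      klDiv (P.snd ⊗ₘ (P.map Prod.swap).condKernel) (ν ⊗ₘ Kernel.const Y P.fst) := by
    intro ν _
    rw [← klDiv_map_swap, Measure.prod_swap, Measure.compProd_const, ← Measure.fst_map_swap,
      Measure.disintegrate]
  rw [hswap, hswap, klDiv_compProd_eq_add (ν := ρ)]
  exact le_add_self

-- `p` is the conditional density of the output given the input, `r` an arbitrary output density and
-- `f` the metric of a mismatched detector.
lemma klDiv_prod_marginals_bounds [StandardBorelSpace X] [Nonempty X]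
    {γ : Measure X} [IsProbabilityMeasure γ] {lam : Measure Y}
    [SigmaFinite lam] {p : X × Y → ℝ} (hpm : Measurable p) (hp : ∀ z, 0 < p z)
    (hp1 : ∀ x, ∫⁻ y, ENNReal.ofReal (p (x, y)) ∂lam = 1)
    {P : Measure (X × Y)} (hP : P = (γ.prod lam).withDensity fun z => ENNReal.ofReal (p z))
    (hlogp : Integrable (fun z => Real.log (p z)) P)
    {r : Y → ℝ} (hrm : Measurable r) (hr : ∀ y, 0 < r y)
    (hr1 : ∫⁻ y, ENNReal.ofReal (r y) ∂lam = 1)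
    (hlogr : Integrable (fun z => Real.log (r z.2)) P)
    {f : X × Y → ℝ} (hfm : Measurable f) (hf : ∀ z, 0 < f z)
    (hfr : ∀ y, ∫⁻ x, ENNReal.ofReal (f (x, y)) ∂γ = ENNReal.ofReal (r y))
    (hlogf : Integrable (fun z => Real.log (f z)) P) :
    (klDiv P (P.fst.prod P.snd)).toReal
        ∈ Set.Icc (∫ z, Real.log (f z) ∂P - ∫ z, Real.log (r z.2) ∂P)
          (∫ z, Real.log (p z) ∂P - ∫ z, Real.log (r z.2) ∂P) := by
  have hfst : P.fst = γ := by
    refine Measure.ext_of_lintegral _ fun F hF => ?_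
    rw [Measure.fst, lintegral_map hF measurable_fst, hP,
      lintegral_withDensity_eq_lintegral_mul _ (by fun_prop) (by fun_prop),
      lintegral_prod _ (by fun_prop)]
    refine lintegral_congr fun x => ?_
    simp only [Pi.mul_apply]
    rw [lintegral_mul_const _ (by fun_prop), hp1, one_mul]
  have : IsProbabilityMeasure P := ⟨by rw [← Measure.fst_univ, hfst, measure_univ]⟩
  set ρ := lam.withDensity fun y => ENNReal.ofReal (r y) with hρ
  have : IsProbabilityMeasure ρ := ⟨by simpa [hρ] using hr1⟩
  obtain ⟨hfin, hkl⟩ := klDiv_withDensity (μ := P) (ν := P.fst.prod ρ) (lam := γ.prod lam)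
    hpm hp (by fun_prop) (fun z => hr z.2) hP
    (by rw [hfst, hρ, prod_withDensity_right (by fun_prop)]) hlogp hlogr
  have hle := klDiv_prod_marginals_le P ρ
  constructor
  · rw [← integral_sub hlogf hlogr]
    have hlog : ∀ z : X × Y, Real.log (f z) - Real.log (r z.2) = Real.log (f z / r z.2) :=
      fun z => (Real.log_div (hf z).ne' (hr z.2).ne').symm
    simp_rw [hlog]
    refine integral_log_le_toReal_klDiv (ne_top_of_le_ne_top hfin hle) (by fun_prop)
      (fun z => div_pos (hf z) (hr z.2)) (le_of_eq ?_) ?_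
    · rw [hfst, lintegral_prod_symm _ (by fun_prop)]
      have hone : ∀ y, ∫⁻ x, ENNReal.ofReal (f (x, y) / r y) ∂γ = 1 := by
        intro y
        simp_rw [ENNReal.ofReal_div_of_pos (hr y), div_eq_mul_inv]
        rw [lintegral_mul_const _ (by fun_prop), hfr,
          ENNReal.mul_inv_cancel (by simpa using hr y) ENNReal.ofReal_ne_top]
      simp [hone]
    · exact (hlogf.sub hlogr).congr (ae_of_all _ hlog)
  · exact hkl ▸ ENNReal.toReal_mono hfin hle

end KullbackLeibler

section ComplexGaussian

/-- The density of the circularly symmetric complex Gaussian law of variance `v > 0`. -/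
noncomputable def cnDensity (v : ℝ) (z : ℂ) : ℝ := (Real.pi * v)⁻¹ * Real.exp (-(‖z‖ ^ 2 / v))

/-- The complex Gaussian law `CN(m, v)`, encoded as the law of `m + √v z` with `z ∼ CN(0,1)`, so
that `v = 0` gives the Dirac mass at `m`. -/
noncomputable def complexGaussian (m : ℂ) (v : ℝ) : Measure ℂ :=
  stdCN.map fun z => m + (Real.sqrt v : ℂ) * z

lemma cnDensity_pos {v : ℝ} (hv : 0 < v) (z : ℂ) : 0 < cnDensity v z := by
  unfold cnDensity; positivity

lemma log_cnDensity {v : ℝ} (hv : 0 < v) (z : ℂ) :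
    Real.log (cnDensity v z) = -Real.log Real.pi - Real.log v - ‖z‖ ^ 2 / v := by
  have := Real.pi_pos
  rw [cnDensity, Real.log_mul (by positivity) (by positivity), Real.log_exp, Real.log_inv,
    Real.log_mul (by positivity) (by positivity)]
  ring

@[fun_prop]
lemma measurable_cnDensity {α : Type*} [MeasurableSpace α] {v : α → ℝ} {z : α → ℂ}
    (hv : Measurable v) (hz : Measurable z) : Measurable fun a => cnDensity (v a) (z a) := by
  unfold cnDensity; fun_prop

lemma gaussianPDF_mul_gaussianPDF (x y : ℝ) :
    gaussianPDF 0 (1 / 2) x * gaussianPDF 0 (1 / 2) y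
      = ENNReal.ofReal (cnDensity 1 (Complex.measurableEquivRealProd.symm (x, y))) := by
  rw [gaussianPDF, gaussianPDF, ← ENNReal.ofReal_mul (gaussianPDFReal_nonneg _ _ _)]
  congr 1
  have hvar : 2 * Real.pi * ((1 / 2 : NNReal) : ℝ) = Real.pi := by push_cast; ring
  rw [gaussianPDFReal, gaussianPDFReal, cnDensity, Complex.sq_norm, Complex.normSq_apply, hvar,
    mul_mul_mul_comm, ← mul_inv, Real.mul_self_sqrt Real.pi_pos.le, ← Real.exp_add]
  congr 2
  · ring
  · simp only [Complex.measurableEquivRealProd_symm_apply]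
    push_cast
    ring

instance : IsProbabilityMeasure stdCN :=
  Measure.isProbabilityMeasure_map Complex.measurableEquivRealProd.symm.measurable.aemeasurable

instance (m : ℂ) (v : ℝ) : IsProbabilityMeasure (complexGaussian m v) :=
  Measure.isProbabilityMeasure_map (by fun_prop)

lemma stdCN_eq_withDensity :
    stdCN = (volume : Measure ℂ).withDensity fun z => ENNReal.ofReal (cnDensity 1 z) := by
  have hmeas : Measurable (fun p : ℝ × ℝ => (⟨p.1, p.2⟩ : ℂ)) :=
    Complex.measurableEquivRealProd.symm.measurable
  refine Measure.ext_of_lintegral _ fun f hf => ?_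
  rw [lintegral_withDensity_eq_lintegral_mul _ (by fun_prop) hf, stdCN, lintegral_map hf hmeas,
    gaussianReal_of_var_ne_zero _ (by norm_num), prod_withDensity (by fun_prop) (by fun_prop),
    lintegral_withDensity_eq_lintegral_mul _ (by fun_prop)
      (show Measurable fun p : ℝ × ℝ => f ⟨p.1, p.2⟩ from hf.comp hmeas),
    ← (Complex.volume_preserving_equiv_real_prod.symm).lintegral_comp (by fun_prop)]
  refine lintegral_congr fun p => ?_
  simp only [Pi.mul_apply, gaussianPDF_mul_gaussianPDF]
  rfl

lemma complexGaussian_zero_one : complexGaussian 0 1 = stdCN := by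
  simp [complexGaussian]

lemma lintegral_complexGaussian (m : ℂ) (v : ℝ) {f : ℂ → ENNReal} (hf : Measurable f) :
    ∫⁻ y, f y ∂complexGaussian m v = ∫⁻ z, f (m + (Real.sqrt v : ℂ) * z) ∂stdCN :=
  lintegral_map hf (by fun_prop)

lemma cnDensity_sqrt_smul {v : ℝ} (hv : 0 < v) (z : ℂ) :
    cnDensity v (Real.sqrt v • z) = v⁻¹ * cnDensity 1 z := by
  have hnorm : ‖Real.sqrt v • z‖ ^ 2 = v * ‖z‖ ^ 2 := by
    rw [norm_smul, mul_pow, Real.norm_eq_abs, sq_abs, Real.sq_sqrt hv.le]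
  rw [cnDensity, cnDensity, hnorm]
  field_simp

lemma complexGaussian_eq_withDensity (m : ℂ) {v : ℝ} (hv : 0 < v) :
    complexGaussian m v = volume.withDensity fun y => ENNReal.ofReal (cnDensity v (y - m)) := by
  refine Measure.ext_of_lintegral _ fun f hf => ?_
  have hfinrank : |(Real.sqrt v ^ Module.finrank ℝ ℂ)⁻¹| = v⁻¹ := by
    rw [Complex.finrank_real_complex, Real.sq_sqrt hv.le, abs_of_pos (by positivity)]
  have hscale := lintegral_map (μ := (volume : Measure ℂ))
    (f := fun y => ENNReal.ofReal (cnDensity v y) * f (m + y)) (by fun_prop)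
    (measurable_const_smul (Real.sqrt v))
  rw [Measure.map_addHaar_smul _ (Real.sqrt_pos.2 hv).ne', lintegral_smul_measure, hfinrank,
    smul_eq_mul] at hscale
  simp_rw [cnDensity_sqrt_smul hv, ENNReal.ofReal_mul (inv_pos.2 hv).le, mul_assoc] at hscale
  rw [lintegral_const_mul _ (by fun_prop),
    ENNReal.mul_right_inj (by simpa using hv) ENNReal.ofReal_ne_top] at hscale
  rw [lintegral_complexGaussian m v hf, stdCN_eq_withDensity,
    lintegral_withDensity_eq_lintegral_mul _ (by fun_prop) (by fun_prop),
    lintegral_withDensity_eq_lintegral_mul _ (by fun_prop) hf]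
  calc _ = ∫⁻ y, ENNReal.ofReal (cnDensity v y) * f (m + y) := by
        simpa only [Complex.real_smul, Pi.mul_apply] using hscale.symm
    _ = _ := by
        rw [← lintegral_add_left_eq_self
          ((fun y => ENNReal.ofReal (cnDensity v (y - m))) * f) m]
        simp

lemma lintegral_complexGaussian_eq_lintegral_mul (m : ℂ) {v : ℝ} (hv : 0 < v)
    {f : ℂ → ENNReal} (hf : Measurable f) :
    ∫⁻ y, f y ∂complexGaussian m v = ∫⁻ y, ENNReal.ofReal (cnDensity v (y - m)) * f y := by
  rw [complexGaussian_eq_withDensity m hv,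
    lintegral_withDensity_eq_lintegral_mul _ (by fun_prop) hf]
  rfl

lemma lintegral_cnDensity_sub (m : ℂ) {v : ℝ} (hv : 0 < v) :
    ∫⁻ y, ENNReal.ofReal (cnDensity v (y - m)) = 1 := by
  simpa using (lintegral_complexGaussian_eq_lintegral_mul m hv (f := 1) measurable_one).symm

/-- The coefficient of the linear estimate of `x ∼ CN(0,1)` from `m x + w`, `w ∼ CN(0,v)`. -/
noncomputable def mmseCoeff (m : ℂ) (v : ℝ) : ℂ := starRingEnd ℂ m / ((v + ‖m‖ ^ 2 : ℝ) : ℂ)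

-- Completing the square: prior times likelihood is marginal times posterior.
lemma cnDensity_mul_cnDensity (m x y : ℂ) {v : ℝ} (hv : 0 < v) :
    cnDensity 1 x * cnDensity v (y - m * x)
      = cnDensity (v + ‖m‖ ^ 2) y *
        cnDensity (v / (v + ‖m‖ ^ 2)) (x - mmseCoeff m v * y) := by
  set d : ℝ := v + ‖m‖ ^ 2 with hd
  have hdpos : 0 < d := by positivity
  have hdc : (d : ℂ) ≠ 0 := by exact_mod_cast hdpos.ne'
  have hsq : ‖(d : ℂ) * x - starRingEnd ℂ m * y‖ ^ 2
      = ‖x‖ ^ 2 * v * d + ‖y - m * x‖ ^ 2 * d - ‖y‖ ^ 2 * v := by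
    rw [hd]
    simp only [Complex.sq_norm, Complex.normSq_apply, Complex.sub_re, Complex.sub_im,
      Complex.mul_re, Complex.mul_im, Complex.conj_re, Complex.conj_im, Complex.ofReal_re,
      Complex.ofReal_im]
    ring
  have herr : ‖x - mmseCoeff m v * y‖ ^ 2
      = ‖(d : ℂ) * x - starRingEnd ℂ m * y‖ ^ 2 / d ^ 2 := by
    have : x - mmseCoeff m v * y = ((d : ℂ) * x - starRingEnd ℂ m * y) / d := by
      rw [mmseCoeff, ← hd]
      field_simp
    rw [this, norm_div, div_pow, Complex.norm_real, Real.norm_eq_abs, sq_abs]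
  unfold cnDensity
  rw [herr, hsq, mul_mul_mul_comm, mul_mul_mul_comm (Real.pi * d)⁻¹, ← Real.exp_add, ← Real.exp_add]
  congr 1
  · field_simp
  · congr 1
    field_simp
    ring

lemma lintegral_stdCN_cnDensity_sub_mul (m y : ℂ) {v : ℝ} (hv : 0 < v) :
    ∫⁻ x, ENNReal.ofReal (cnDensity v (y - m * x)) ∂stdCN
      = ENNReal.ofReal (cnDensity (v + ‖m‖ ^ 2) y) := by
  have hd : 0 < v + ‖m‖ ^ 2 := by positivity
  rw [← complexGaussian_zero_one,
    lintegral_complexGaussian_eq_lintegral_mul _ one_pos (by fun_prop)]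
  simp_rw [sub_zero, ← ENNReal.ofReal_mul (cnDensity_pos one_pos _).le,
    cnDensity_mul_cnDensity m _ y hv, ENNReal.ofReal_mul (cnDensity_pos hd _).le]
  rw [lintegral_const_mul _ (by fun_prop), lintegral_cnDensity_sub _ (by positivity), mul_one]

-- Bayes' rule, in integrated form.
lemma lintegral_stdCN_lintegral_complexGaussian (m : ℂ) {v : ℝ} (hv : 0 < v)
    {f : ℂ × ℂ → ENNReal} (hf : Measurable f) :
    ∫⁻ x, ∫⁻ y, f (x, y) ∂complexGaussian (m * x) v ∂stdCN
      = ∫⁻ y, ∫⁻ x, f (x, y) ∂complexGaussian (mmseCoeff m v * y) (v / (v + ‖m‖ ^ 2))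
          ∂complexGaussian 0 (v + ‖m‖ ^ 2) := by
  have hd : 0 < v + ‖m‖ ^ 2 := by positivity
  have hs : 0 < v / (v + ‖m‖ ^ 2) := by positivity
  have hlik : ∀ x, ∫⁻ y, f (x, y) ∂complexGaussian (m * x) v
      = ∫⁻ y, ENNReal.ofReal (cnDensity v (y - m * x)) * f (x, y) := fun x =>
    lintegral_complexGaussian_eq_lintegral_mul _ hv (by fun_prop)
  have hpost : ∀ y, ∫⁻ x, f (x, y) ∂complexGaussian (mmseCoeff m v * y) (v / (v + ‖m‖ ^ 2))
      = ∫⁻ x, ENNReal.ofReal (cnDensity (v / (v + ‖m‖ ^ 2)) (x - mmseCoeff m v * y)) * f (x, y) :=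
    fun y => lintegral_complexGaussian_eq_lintegral_mul _ hs (by fun_prop)
  simp_rw [hlik, hpost]
  rw [← complexGaussian_zero_one,
    lintegral_complexGaussian_eq_lintegral_mul _ one_pos (by fun_prop),
    lintegral_complexGaussian_eq_lintegral_mul _ hd (by fun_prop)]
  simp_rw [sub_zero, ← lintegral_const_mul' _ _ ENNReal.ofReal_ne_top]
  rw [lintegral_lintegral_swap (by fun_prop)]
  refine lintegral_congr fun y => lintegral_congr fun x => ?_
  rw [← mul_assoc, ← mul_assoc, ← ENNReal.ofReal_mul (cnDensity_pos one_pos _).le,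
    ← ENNReal.ofReal_mul (cnDensity_pos hd _).le, cnDensity_mul_cnDensity m x y hv]

lemma lintegral_complexGaussian_complexGaussian_mul (α m : ℂ) {s v : ℝ} (hs : 0 ≤ s) (hv : 0 < v)
    {f : ℂ → ENNReal} (hf : Measurable f) :
    ∫⁻ h, ∫⁻ y, f y ∂complexGaussian (α * h) v ∂complexGaussian m s
      = ∫⁻ y, f y ∂complexGaussian (α * m) (v + ‖α‖ ^ 2 * s) := by
  have hvar : ‖α * (Real.sqrt s : ℂ)‖ ^ 2 = ‖α‖ ^ 2 * s := by
    rw [norm_mul, mul_pow, Complex.norm_real, Real.norm_eq_abs, sq_abs, Real.sq_sqrt hs]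
  simp_rw [lintegral_complexGaussian_eq_lintegral_mul _ hv hf]
  rw [lintegral_complexGaussian _ _ (by fun_prop), lintegral_lintegral_swap (by fun_prop),
    lintegral_complexGaussian_eq_lintegral_mul _ (by positivity) hf]
  refine lintegral_congr fun y => ?_
  rw [lintegral_mul_const _ (by fun_prop), ← hvar,
    ← lintegral_stdCN_cnDensity_sub_mul (α * (Real.sqrt s : ℂ)) _ hv]
  simp only [mul_add, mul_assoc, sub_sub]

end ComplexGaussian

section Moments

lemma integral_stdCN {F : Type*} [NormedAddCommGroup F] [NormedSpace ℝ F] (f : ℂ → F) :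
    ∫ z, f z ∂stdCN = ∫ z, cnDensity 1 z • f z := by
  rw [stdCN_eq_withDensity, integral_withDensity_eq_integral_toReal_smul (by fun_prop)
    (ae_of_all _ fun _ => ENNReal.ofReal_lt_top)]
  simp only [ENNReal.toReal_ofReal (cnDensity_pos one_pos _).le]

lemma integral_norm_sq_pow_stdCN (n : ℕ) : ∫ z, (‖z‖ ^ 2) ^ n ∂stdCN = n.factorial := by
  have hgamma := Complex.integral_rpow_mul_exp_neg_rpow (p := 2) (q := 2 * n) (by norm_num)
    (by linarith [n.cast_nonneg (α := ℝ)])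
  have hintegrand : ∀ z : ℂ, cnDensity 1 z • (‖z‖ ^ 2) ^ n
      = Real.pi⁻¹ * (‖z‖ ^ (2 * n : ℝ) * Real.exp (-‖z‖ ^ (2 : ℝ))) := by
    intro z
    rw [cnDensity, Real.rpow_ofNat, ← pow_mul, mul_one, div_one, smul_eq_mul,
      show (2 * n : ℝ) = ((2 * n : ℕ) : ℝ) by push_cast; ring, Real.rpow_natCast]
    ring
  simp_rw [integral_stdCN, hintegrand]
  rw [integral_const_mul, hgamma, show ((2 * n + 2) / 2 : ℝ) = n + 1 by ring,
    Real.Gamma_nat_eq_factorial]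
  field_simp

lemma integrable_norm_sq_pow_stdCN (n : ℕ) :
    Integrable (fun z : ℂ => (‖z‖ ^ 2) ^ n) stdCN := by
  refine Integrable.of_integral_ne_zero ?_
  rw [integral_norm_sq_pow_stdCN]
  exact_mod_cast n.factorial_ne_zero

lemma norm_sqrt_mul_sq {v : ℝ} (hv : 0 ≤ v) (z : ℂ) :
    ‖(Real.sqrt v : ℂ) * z‖ ^ 2 = v * ‖z‖ ^ 2 := by
  rw [norm_mul, mul_pow, Complex.norm_real, Real.norm_eq_abs, sq_abs, Real.sq_sqrt hv]

lemma integrable_norm_sq_pow_complexGaussian {v : ℝ} (hv : 0 ≤ v) (n : ℕ) :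
    Integrable (fun z : ℂ => (‖z‖ ^ 2) ^ n) (complexGaussian 0 v) := by
  rw [complexGaussian, integrable_map_measure (by fun_prop) (by fun_prop)]
  simp only [Function.comp_def, zero_add, norm_sqrt_mul_sq hv, mul_pow]
  exact (integrable_norm_sq_pow_stdCN n).const_mul _

lemma integral_norm_sq_pow_complexGaussian {v : ℝ} (hv : 0 ≤ v) (n : ℕ) :
    ∫ z, (‖z‖ ^ 2) ^ n ∂complexGaussian 0 v = n.factorial * v ^ n := by
  rw [complexGaussian, integral_map (by fun_prop) (by fun_prop)]
  simp only [zero_add, norm_sqrt_mul_sq hv, mul_pow]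
  rw [integral_const_mul, integral_norm_sq_pow_stdCN, mul_comm]

lemma integrable_id_stdCN : Integrable (fun z : ℂ => z) stdCN := by
  refine Integrable.mono' ((integrable_norm_sq_pow_stdCN 1).add (integrable_const 1))
    measurable_id.aestronglyMeasurable (ae_of_all _ fun z => ?_)
  simp only [Pi.add_apply, pow_one]
  nlinarith [sq_nonneg (‖z‖ - 1), norm_nonneg z]

lemma integral_id_stdCN : ∫ z, z ∂stdCN = 0 := by
  have hodd := integral_neg_eq_self (fun z : ℂ => cnDensity 1 z • z) volume
  simp only [cnDensity, norm_neg, smul_neg, integral_neg] at hodd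
  rw [integral_stdCN]
  exact self_eq_neg.1 hodd.symm

lemma integral_id_complexGaussian (m : ℂ) (v : ℝ) : ∫ z, z ∂complexGaussian m v = m := by
  rw [complexGaussian, integral_map (f := fun z => z) (by fun_prop) (by fun_prop),
    integral_add (integrable_const m) (integrable_id_stdCN.const_mul _), integral_const_mul]
  simp [integral_id_stdCN]

lemma lintegral_norm_sub_sq_complexGaussian (a m : ℂ) {v : ℝ} (hv : 0 ≤ v) :
    ∫⁻ y, ENNReal.ofReal (‖y - a‖ ^ 2) ∂complexGaussian m v
      = ENNReal.ofReal (‖m - a‖ ^ 2 + v) := by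
  have hexpand : ∀ z : ℂ, ‖m + (Real.sqrt v : ℂ) * z - a‖ ^ 2
      = ‖m - a‖ ^ 2 + 2 * (Real.sqrt v * inner ℝ (m - a) z) + v * (‖z‖ ^ 2) ^ 1 := by
    intro z
    rw [add_sub_right_comm, norm_add_sq_real, norm_sqrt_mul_sq hv, ← Complex.real_smul,
      inner_smul_right, pow_one]
  have hinner : Integrable (fun z : ℂ => inner ℝ (m - a) z) stdCN :=
    integrable_id_stdCN.const_inner _
  have hcross : ∫ z, inner ℝ (m - a) z ∂stdCN = 0 := by
    rw [integral_inner (f := fun z : ℂ => z) integrable_id_stdCN, integral_id_stdCN,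
      inner_zero_right]
  have hsq := integrable_norm_sq_pow_stdCN 1
  have hint : Integrable (fun z : ℂ => ‖m + (Real.sqrt v : ℂ) * z - a‖ ^ 2) stdCN := by
    simp_rw [hexpand]
    fun_prop
  rw [lintegral_complexGaussian _ _ (by fun_prop),
    ← ofReal_integral_eq_lintegral_ofReal hint (ae_of_all _ fun _ => sq_nonneg _)]
  congr 1
  simp_rw [hexpand]
  rw [integral_add (by fun_prop) (by fun_prop), integral_add (by fun_prop) (by fun_prop),
    integral_const_mul, integral_const_mul, integral_const_mul, hcross, integral_norm_sq_pow_stdCN]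
  simp

end Moments

section ChannelEstimation

lemma condExp_comap_ae_eq_of_indepFun_sub {Ω β F : Type*} [MeasurableSpace Ω] [MeasurableSpace β]
    [NormedAddCommGroup F] [NormedSpace ℝ F] [CompleteSpace F] [MeasurableSpace F] [BorelSpace F]
    [SecondCountableTopology F] {P : Measure Ω} [IsProbabilityMeasure P] {X : Ω → F} {Y : Ω → β}
    {g : β → F} (hX : Measurable X) (hY : Measurable Y) (hg : Measurable g)
    (hXi : Integrable X P) (hgi : Integrable (fun ω => g (Y ω)) P)
    (hind : IndepFun (fun ω => X ω - g (Y ω)) Y P) (hmean : ∫ ω, X ω - g (Y ω) ∂P = 0) :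
    condExp (MeasurableSpace.comap Y inferInstance) P X =ᵐ[P] fun ω => g (Y ω) := by
  have herr : Measurable fun ω => X ω - g (Y ω) := hX.sub (hg.comp hY)
  have hgm : StronglyMeasurable[MeasurableSpace.comap Y inferInstance] fun ω => g (Y ω) :=
    (hg.comp (comap_measurable Y)).stronglyMeasurable
  have hzero := condExp_indep_eq herr.comap_le hY.comap_le
    (comap_measurable (fun ω => X ω - g (Y ω))).stronglyMeasurable hind
  rw [← add_sub_cancel (fun ω => g (Y ω)) X]
  filter_upwards [condExp_add hgi (hXi.sub hgi) (MeasurableSpace.comap Y inferInstance), hzero]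
    with ω hadd hω
  rw [hadd, Pi.add_apply, condExp_of_stronglyMeasurable hY.comap_le hgm hgi]
  exact add_eq_left.2 (hω.trans hmean)

instance : IsProbabilityMeasure sampleLaw := by unfold sampleLaw; infer_instance

lemma lintegral_sampleLaw {f : Sample → ENNReal} (hf : Measurable f) :
    ∫⁻ ω, f ω ∂sampleLaw
      = ∫⁻ h, ∫⁻ w₀, ∫⁻ x, ∫⁻ w, f (h, w₀, x, w) ∂stdCN ∂stdCN ∂stdCN ∂stdCN := by
  rw [sampleLaw, lintegral_prod _ (by fun_prop)]
  refine lintegral_congr fun h => ?_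
  rw [lintegral_prod _ (by fun_prop)]
  refine lintegral_congr fun w₀ => ?_
  rw [lintegral_prod _ (by fun_prop)]

@[fun_prop]
lemma measurable_fading : Measurable fading := measurable_fst

@[fun_prop]
lemma measurable_dataSymbol : Measurable dataSymbol := by unfold dataSymbol; fun_prop

@[fun_prop]
lemma measurable_trainObs (E : ℝ) : Measurable (trainObs E) := by unfold trainObs; fun_prop

@[fun_prop]
lemma measurable_dataObs (ρ : ℝ) : Measurable (dataObs ρ) := by unfold dataObs; fun_prop

lemma integrable_fading : Integrable fading sampleLaw := integrable_id_stdCN.comp_fst _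

lemma integrable_trainObs (E : ℝ) : Integrable (trainObs E) sampleLaw :=
  (integrable_fading.const_mul _).add
    ((integrable_id_stdCN.comp_fst (stdCN.prod stdCN)).comp_snd stdCN)

/-- The gain of the linear MMSE estimator of the fading coefficient for training energy `E`. -/
noncomputable def mmseGain (E : ℝ) : ℂ := mmseCoeff (Real.sqrt E) 1

lemma lintegral_fading_trainObs {E : ℝ} (hE : 0 ≤ E) {f : ℂ × ℂ → ENNReal} (hf : Measurable f) :
    ∫⁻ h, ∫⁻ w₀, f (h, (Real.sqrt E : ℂ) * h + w₀) ∂stdCN ∂stdCN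
      = ∫⁻ y, ∫⁻ h, f (h, y) ∂complexGaussian (mmseGain E * y) (1 / (1 + E))
          ∂complexGaussian 0 (1 + E) := by
  have hnorm : ‖(Real.sqrt E : ℂ)‖ ^ 2 = E := by
    simpa using norm_sqrt_mul_sq hE 1
  have hbayes := lintegral_stdCN_lintegral_complexGaussian (Real.sqrt E : ℂ) one_pos hf
  rw [hnorm] at hbayes
  rw [mmseGain, ← hbayes]
  refine lintegral_congr fun h => ?_
  rw [lintegral_complexGaussian _ _ (by fun_prop)]
  simp

lemma map_trainObs_error {E : ℝ} (hE : 0 ≤ E) :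
    sampleLaw.map (fun ω => (fading ω - mmseGain E * trainObs E ω, trainObs E ω))
      = (complexGaussian 0 (1 / (1 + E))).prod (complexGaussian 0 (1 + E)) := by
  refine Measure.ext_of_lintegral _ fun f hf => ?_
  rw [lintegral_map hf (by fun_prop), lintegral_sampleLaw (by fun_prop),
    lintegral_prod_symm _ (by fun_prop)]
  simp only [trainObs, fading, lintegral_const, measure_univ, mul_one]
  rw [lintegral_fading_trainObs hE (f := fun q => f (q.1 - mmseGain E * q.2, q.2)) (by fun_prop)]
  refine lintegral_congr fun y => ?_
  rw [lintegral_complexGaussian _ _ (by fun_prop), lintegral_complexGaussian _ _ (by fun_prop)]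
  simp only [add_sub_cancel_left, zero_add]

lemma mmseEstimate_ae_eq {E : ℝ} (hE : 0 ≤ E) :
    mmseEstimate E =ᵐ[sampleLaw] fun ω => mmseGain E * trainObs E ω := by
  have hpair := map_trainObs_error hE
  have herr : sampleLaw.map (fun ω => fading ω - mmseGain E * trainObs E ω)
      = complexGaussian 0 (1 / (1 + E)) := by
    rw [← Measure.fst_map_prodMk (measurable_trainObs E), hpair, Measure.fst_prod]
  have hobs : sampleLaw.map (trainObs E) = complexGaussian 0 (1 + E) := by
    rw [← Measure.snd_map_prodMk (X := fun ω => fading ω - mmseGain E * trainObs E ω)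
      (by fun_prop), hpair, Measure.snd_prod]
  refine condExp_comap_ae_eq_of_indepFun_sub (g := fun y => mmseGain E * y) measurable_fading
    (measurable_trainObs E) (by fun_prop) integrable_fading ((integrable_trainObs E).const_mul _)
    ?_ ?_
  · rw [indepFun_iff_map_prod_eq_prod_map_map (by fun_prop) (by fun_prop), herr, hobs, hpair]
  · rw [← integral_map (φ := fun ω => fading ω - mmseGain E * trainObs E ω) (f := fun z => z)
      (by fun_prop) (by fun_prop), herr, integral_id_complexGaussian]

end ChannelEstimation

section ChannelLaw

lemma integrable_log_one_add_mul_norm_sq {μ : Measure ℂ} [IsFiniteMeasure μ]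
    (hμ : Integrable (fun z => ‖z‖ ^ 2) μ) {ρ s : ℝ} (hρ : 0 ≤ ρ) (hs : 0 ≤ s) :
    Integrable (fun z => Real.log (1 + ρ * (s + ‖z‖ ^ 2))) μ := by
  have hbound : Integrable (fun z : ℂ => ρ * (s + ‖z‖ ^ 2)) μ :=
    ((integrable_const s).add hμ).const_mul ρ
  refine hbound.mono' (Measurable.aestronglyMeasurable (by fun_prop)) (ae_of_all _ fun z => ?_)
  have ht : 0 ≤ ρ * (s + ‖z‖ ^ 2) := by positivity
  rw [Real.norm_of_nonneg (Real.log_nonneg (by linarith))]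
  linarith [Real.log_le_sub_one_of_pos (show 0 < 1 + ρ * (s + ‖z‖ ^ 2) by linarith)]

lemma integral_log_cnDensity {α : Type*} [MeasurableSpace α] {P : Measure α}
    [IsProbabilityMeasure P] {V : α → ℝ} {D : α → ℂ} (hVm : Measurable V) (hV : ∀ a, 0 < V a)
    (hDm : Measurable D) (hlog : Integrable (fun a => Real.log (V a)) P)
    (hD : ∫⁻ a, ENNReal.ofReal (‖D a‖ ^ 2 / V a) ∂P = 1) :
    Integrable (fun a => Real.log (cnDensity (V a) (D a))) P ∧
      ∫ a, Real.log (cnDensity (V a) (D a)) ∂P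
        = -Real.log Real.pi - ∫ a, Real.log (V a) ∂P - 1 := by
  have hnonneg : ∀ a, 0 ≤ ‖D a‖ ^ 2 / V a := fun a => div_nonneg (sq_nonneg _) (hV a).le
  have hmeas : Measurable fun a => ‖D a‖ ^ 2 / V a := by fun_prop
  have hint : Integrable (fun a => ‖D a‖ ^ 2 / V a) P := by
    refine ⟨hmeas.aestronglyMeasurable, ?_⟩
    rw [hasFiniteIntegral_iff_ofReal (ae_of_all _ hnonneg), hD]
    exact ENNReal.one_lt_top
  have hone : ∫ a, ‖D a‖ ^ 2 / V a ∂P = 1 := by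
    rw [integral_eq_lintegral_of_nonneg_ae (ae_of_all _ hnonneg) hmeas.aestronglyMeasurable, hD,
      ENNReal.toReal_one]
  simp_rw [log_cnDensity (hV _)]
  have hsub : Integrable (fun a => -Real.log Real.pi - Real.log (V a)) P :=
    (integrable_const _).sub hlog
  refine ⟨hsub.sub hint, ?_⟩
  rw [integral_sub hsub hint, integral_sub (integrable_const _) hlog,
    hone, integral_const, probReal_univ, one_smul]

/-- The conditional density of the received symbol `y` given the data symbol `x` and the channel
estimate `c`, at the triple `(x, y, c)`, when the estimation error is `CN(0, s)` and independent of
the estimate. -/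
noncomputable def channelDensity (ρ s : ℝ) (q : ℂ × ℂ × ℂ) : ℝ :=
  cnDensity (1 + ρ * s * ‖q.1‖ ^ 2) (q.2.1 - (Real.sqrt ρ : ℂ) * q.2.2 * q.1)

/-- The joint law of the data symbol, the received symbol and the channel estimate, for an estimate
of law `τ`. -/
noncomputable def channelLaw (ρ s : ℝ) (τ : Measure ℂ) : Measure (ℂ × ℂ × ℂ) :=
  (stdCN.prod (volume.prod τ)).withDensity fun q => ENNReal.ofReal (channelDensity ρ s q)

variable {ρ s : ℝ} {τ : Measure ℂ}

lemma channelDensity_pos (hρ : 0 ≤ ρ) (hs : 0 ≤ s) (q : ℂ × ℂ × ℂ) : 0 < channelDensity ρ s q :=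
  cnDensity_pos (by positivity) _

@[fun_prop]
lemma measurable_channelDensity (ρ s : ℝ) : Measurable (channelDensity ρ s) := by
  unfold channelDensity; fun_prop

variable [IsProbabilityMeasure τ]

lemma lintegral_channelLaw (hρ : 0 ≤ ρ) (hs : 0 ≤ s) {F : ℂ × ℂ × ℂ → ENNReal}
    (hF : Measurable F) :
    ∫⁻ q, F q ∂channelLaw ρ s τ
      = ∫⁻ c, ∫⁻ x, ∫⁻ y, F (x, y, c) ∂complexGaussian ((Real.sqrt ρ : ℂ) * c * x)
          (1 + ρ * s * ‖x‖ ^ 2) ∂stdCN ∂τ := by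
  have hy : ∀ c x, ∫⁻ y, F (x, y, c) ∂complexGaussian ((Real.sqrt ρ : ℂ) * c * x)
        (1 + ρ * s * ‖x‖ ^ 2)
      = ∫⁻ y, ENNReal.ofReal (channelDensity ρ s (x, y, c)) * F (x, y, c) := fun c x =>
    lintegral_complexGaussian_eq_lintegral_mul _ (by positivity) (by fun_prop)
  simp_rw [hy]
  rw [channelLaw, lintegral_withDensity_eq_lintegral_mul _ (by fun_prop) hF,
    lintegral_prod _ (by fun_prop), lintegral_lintegral_swap (f := fun c x => ∫⁻ y,
      ENNReal.ofReal (channelDensity ρ s (x, y, c)) * F (x, y, c)) (by fun_prop)]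
  refine lintegral_congr fun x => ?_
  rw [lintegral_prod_symm _ (by fun_prop)]
  rfl

lemma lintegral_channelDensity (hρ : 0 ≤ ρ) (hs : 0 ≤ s) (x : ℂ) :
    ∫⁻ o, ENNReal.ofReal (channelDensity ρ s (x, o)) ∂(volume.prod τ) = 1 := by
  rw [lintegral_prod_symm _ (by fun_prop)]
  simp only [channelDensity]
  simp_rw [lintegral_cnDensity_sub _ (show 0 < 1 + ρ * s * ‖x‖ ^ 2 by positivity)]
  simp

lemma map_channelLaw_symbol (hρ : 0 ≤ ρ) (hs : 0 ≤ s) :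
    (channelLaw ρ s τ).map (fun q => q.1) = stdCN := by
  refine Measure.ext_of_lintegral _ fun f hf => ?_
  rw [lintegral_map hf (by fun_prop), lintegral_channelLaw hρ hs (by fun_prop)]
  simp

lemma map_channelLaw_estimate (hρ : 0 ≤ ρ) (hs : 0 ≤ s) :
    (channelLaw ρ s τ).map (fun q => q.2.2) = τ := by
  refine Measure.ext_of_lintegral _ fun f hf => ?_
  rw [lintegral_map hf (by fun_prop), lintegral_channelLaw hρ hs (by fun_prop)]
  simp

lemma isProbabilityMeasure_channelLaw (hρ : 0 ≤ ρ) (hs : 0 ≤ s) :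
    IsProbabilityMeasure (channelLaw ρ s τ) := by
  rw [← Measure.isProbabilityMeasure_map_iff (f := fun q => q.1) (by fun_prop),
    map_channelLaw_symbol hρ hs]
  infer_instance

lemma lintegral_norm_sub_sq_div_complexGaussian (a m : ℂ) {u v : ℝ} (hu : 0 < u) (hv : 0 ≤ v) :
    ∫⁻ y, ENNReal.ofReal (‖y - a‖ ^ 2 / u) ∂complexGaussian m v
      = ENNReal.ofReal ((‖m - a‖ ^ 2 + v) / u) := by
  simp_rw [ENNReal.ofReal_div_of_pos hu, div_eq_mul_inv]
  rw [lintegral_mul_const _ (by fun_prop), lintegral_norm_sub_sq_complexGaussian a m hv]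

lemma lintegral_one_add_mul_norm_sq_div_stdCN {A : ℝ} (hA : 0 ≤ A) :
    ∫⁻ x, ENNReal.ofReal ((1 + A * ‖x‖ ^ 2) / (1 + A)) ∂stdCN = 1 := by
  have hsq := integrable_norm_sq_pow_stdCN 1
  have hmean := integral_norm_sq_pow_stdCN 1
  simp only [pow_one] at hsq hmean
  rw [← ofReal_integral_eq_lintegral_ofReal (by fun_prop) (ae_of_all _ fun x => by positivity),
    integral_div, integral_add (by fun_prop) (by fun_prop), integral_const_mul, hmean]
  simp [div_self (show 1 + A ≠ 0 by positivity)]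

lemma integral_log_channelDensity (hρ : 0 ≤ ρ) (hs : 0 ≤ s) :
    Integrable (fun q => Real.log (channelDensity ρ s q)) (channelLaw ρ s τ) ∧
      ∫ q, Real.log (channelDensity ρ s q) ∂channelLaw ρ s τ
        = -Real.log Real.pi - ∫ x, Real.log (1 + ρ * s * ‖x‖ ^ 2) ∂stdCN - 1 := by
  have := isProbabilityMeasure_channelLaw (τ := τ) hρ hs
  have hsq : Integrable (fun x => ‖x‖ ^ 2) stdCN := by simpa using integrable_norm_sq_pow_stdCN 1
  have hlog : Integrable (fun x => Real.log (1 + ρ * s * ‖x‖ ^ 2)) stdCN := by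
    simpa using integrable_log_one_add_mul_norm_sq hsq (mul_nonneg hρ hs) le_rfl
  rw [← map_channelLaw_symbol (τ := τ) hρ hs] at hlog ⊢
  rw [integral_map (by fun_prop) (Measurable.aestronglyMeasurable (by fun_prop))]
  rw [integrable_map_measure (Measurable.aestronglyMeasurable (by fun_prop)) (by fun_prop)] at hlog
  refine integral_log_cnDensity (by fun_prop) (fun q => by positivity) (by fun_prop) hlog ?_
  rw [lintegral_channelLaw hρ hs (by fun_prop)]
  have hy : ∀ c x, ∫⁻ y, ENNReal.ofReal (‖y - (Real.sqrt ρ : ℂ) * c * x‖ ^ 2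
        / (1 + ρ * s * ‖x‖ ^ 2)) ∂complexGaussian ((Real.sqrt ρ : ℂ) * c * x)
          (1 + ρ * s * ‖x‖ ^ 2) = 1 := by
    intro c x
    have hv : 0 < 1 + ρ * s * ‖x‖ ^ 2 := by positivity
    rw [lintegral_norm_sub_sq_div_complexGaussian _ _ hv hv.le]
    simp [div_self hv.ne']
  simp [hy]

/-- The density of the received symbol given the channel estimate that would hold if the received
symbol were Gaussian. -/
noncomputable def outputDensity (ρ s : ℝ) (o : ℂ × ℂ) : ℝ :=
  cnDensity (1 + ρ * (s + ‖o.2‖ ^ 2)) o.1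

/-- The conditional density of the received symbol for a detector that treats the contribution of
the estimation error as Gaussian noise of variance `ρ s`. -/
noncomputable def mismatchedDensity (ρ s : ℝ) (q : ℂ × ℂ × ℂ) : ℝ :=
  cnDensity (1 + ρ * s) (q.2.1 - (Real.sqrt ρ : ℂ) * q.2.2 * q.1)

lemma lintegral_outputDensity (hρ : 0 ≤ ρ) (hs : 0 ≤ s) :
    ∫⁻ o, ENNReal.ofReal (outputDensity ρ s o) ∂(volume.prod τ) = 1 := by
  unfold outputDensity
  rw [lintegral_prod_symm _ (by fun_prop)]
  have hy : ∀ c : ℂ, ∫⁻ y, ENNReal.ofReal (cnDensity (1 + ρ * (s + ‖c‖ ^ 2)) y) = 1 := fun c => by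
    simpa using lintegral_cnDensity_sub 0 (show 0 < 1 + ρ * (s + ‖c‖ ^ 2) by positivity)
  simp [hy]

lemma lintegral_mismatchedDensity (hρ : 0 ≤ ρ) (hs : 0 ≤ s) (o : ℂ × ℂ) :
    ∫⁻ x, ENNReal.ofReal (mismatchedDensity ρ s (x, o)) ∂stdCN
      = ENNReal.ofReal (outputDensity ρ s o) := by
  have h := lintegral_stdCN_cnDensity_sub_mul ((Real.sqrt ρ : ℂ) * o.2) o.1
    (show 0 < 1 + ρ * s by positivity)
  rw [norm_sqrt_mul_sq hρ, add_assoc, ← mul_add] at h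
  exact h

lemma integral_log_outputDensity (hρ : 0 ≤ ρ) (hs : 0 ≤ s)
    (hτ : Integrable (fun c => ‖c‖ ^ 2) τ) :
    Integrable (fun q : ℂ × ℂ × ℂ => Real.log (outputDensity ρ s q.2)) (channelLaw ρ s τ) ∧
      ∫ q, Real.log (outputDensity ρ s q.2) ∂channelLaw ρ s τ
        = -Real.log Real.pi - ∫ c, Real.log (1 + ρ * (s + ‖c‖ ^ 2)) ∂τ - 1 := by
  have := isProbabilityMeasure_channelLaw (τ := τ) hρ hs
  have hlog := integrable_log_one_add_mul_norm_sq hτ hρ hs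
  have hmap : ∫ c, Real.log (1 + ρ * (s + ‖c‖ ^ 2)) ∂τ
      = ∫ q, Real.log (1 + ρ * (s + ‖q.2.2‖ ^ 2)) ∂channelLaw ρ s τ := by
    conv_lhs => rw [← map_channelLaw_estimate (τ := τ) hρ hs]
    exact integral_map (by fun_prop) (Measurable.aestronglyMeasurable (by fun_prop))
  rw [← map_channelLaw_estimate (τ := τ) hρ hs,
    integrable_map_measure (Measurable.aestronglyMeasurable (by fun_prop)) (by fun_prop)] at hlog
  rw [hmap]
  refine integral_log_cnDensity (by fun_prop) (fun q => by positivity) (by fun_prop) hlog ?_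
  rw [lintegral_channelLaw hρ hs (by fun_prop)]
  have hc : ∀ c : ℂ, ∫⁻ x, ∫⁻ y, ENNReal.ofReal (‖y‖ ^ 2 / (1 + ρ * (s + ‖c‖ ^ 2)))
      ∂complexGaussian ((Real.sqrt ρ : ℂ) * c * x) (1 + ρ * s * ‖x‖ ^ 2) ∂stdCN = 1 := by
    intro c
    rw [← lintegral_one_add_mul_norm_sq_div_stdCN (A := ρ * (s + ‖c‖ ^ 2)) (by positivity)]
    refine lintegral_congr fun x => ?_
    have h := lintegral_norm_sub_sq_div_complexGaussian 0 ((Real.sqrt ρ : ℂ) * c * x)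
      (show 0 < 1 + ρ * (s + ‖c‖ ^ 2) by positivity) (show 0 ≤ 1 + ρ * s * ‖x‖ ^ 2 by positivity)
    simp only [sub_zero] at h
    rw [h, mul_assoc, norm_sqrt_mul_sq hρ, norm_mul]
    congr 2
    ring
  simp [hc]

lemma integral_log_mismatchedDensity (hρ : 0 ≤ ρ) (hs : 0 ≤ s) :
    Integrable (fun q => Real.log (mismatchedDensity ρ s q)) (channelLaw ρ s τ) ∧
      ∫ q, Real.log (mismatchedDensity ρ s q) ∂channelLaw ρ s τ
        = -Real.log Real.pi - Real.log (1 + ρ * s) - 1 := by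
  have := isProbabilityMeasure_channelLaw (τ := τ) hρ hs
  have hv : 0 < 1 + ρ * s := by positivity
  have hconst : ∫ _, Real.log (1 + ρ * s) ∂channelLaw ρ s τ = Real.log (1 + ρ * s) := by simp
  rw [← hconst]
  refine integral_log_cnDensity (by fun_prop) (fun _ => hv) (by fun_prop) (integrable_const _) ?_
  rw [lintegral_channelLaw hρ hs (by fun_prop)]
  have hc : ∀ c, ∫⁻ x, ∫⁻ y, ENNReal.ofReal (‖y - (Real.sqrt ρ : ℂ) * c * x‖ ^ 2 / (1 + ρ * s))
      ∂complexGaussian ((Real.sqrt ρ : ℂ) * c * x) (1 + ρ * s * ‖x‖ ^ 2) ∂stdCN = 1 := by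
    intro c
    rw [← lintegral_one_add_mul_norm_sq_div_stdCN (mul_nonneg hρ hs)]
    refine lintegral_congr fun x => ?_
    rw [lintegral_norm_sub_sq_div_complexGaussian _ _ hv (by positivity)]
    simp
  simp [hc]

lemma klDiv_channelLaw_bounds (hρ : 0 ≤ ρ) (hs : 0 ≤ s)
    (hτ : Integrable (fun c => ‖c‖ ^ 2) τ) :
    (InformationTheory.klDiv (channelLaw ρ s τ)
        ((channelLaw ρ s τ).fst.prod (channelLaw ρ s τ).snd)).toReal
      ∈ Set.Icc (∫ c, Real.log (1 + ρ * (s + ‖c‖ ^ 2)) ∂τ - Real.log (1 + ρ * s))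
        (∫ c, Real.log (1 + ρ * (s + ‖c‖ ^ 2)) ∂τ
          - ∫ x, Real.log (1 + ρ * s * ‖x‖ ^ 2) ∂stdCN) := by
  obtain ⟨hlogp, hp⟩ := integral_log_channelDensity (τ := τ) hρ hs
  obtain ⟨hlogr, hr⟩ := integral_log_outputDensity hρ hs hτ
  obtain ⟨hlogf, hf⟩ := integral_log_mismatchedDensity (τ := τ) hρ hs
  have hbounds := klDiv_prod_marginals_bounds (measurable_channelDensity ρ s)
    (channelDensity_pos hρ hs) (lintegral_channelDensity hρ hs) (P := channelLaw ρ s τ) rfl hlogp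
    (r := outputDensity ρ s) (by unfold outputDensity; fun_prop)
    (fun o => cnDensity_pos (by positivity) _) (lintegral_outputDensity hρ hs) hlogr
    (f := mismatchedDensity ρ s) (by unfold mismatchedDensity; fun_prop)
    (fun q => cnDensity_pos (by positivity) _) (lintegral_mismatchedDensity hρ hs) hlogf
  rw [hp, hr, hf] at hbounds
  convert hbounds using 2 <;> ring

end ChannelLaw

section DataInformation

variable {ρ E : ℝ}

lemma map_mmseGain_mul_complexGaussian (hE : 0 ≤ E) :
    (complexGaussian 0 (1 + E)).map (fun y => mmseGain E * y)
      = complexGaussian 0 (E / (1 + E)) := by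
  have hE1 : 0 < 1 + E := by positivity
  have hgain : mmseGain E * (Real.sqrt (1 + E) : ℂ) = (Real.sqrt (E / (1 + E)) : ℂ) := by
    have hreal : Real.sqrt E / (1 + E) * Real.sqrt (1 + E) = Real.sqrt (E / (1 + E)) := by
      rw [Real.sqrt_div hE, div_mul_eq_mul_div, div_eq_div_iff hE1.ne' (Real.sqrt_pos.2 hE1).ne',
        mul_assoc, Real.mul_self_sqrt hE1.le]
    rw [← hreal, mmseGain, mmseCoeff, Complex.conj_ofReal, Complex.norm_real, Real.norm_eq_abs,
      sq_abs, Real.sq_sqrt hE]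
    push_cast
    rfl
  rw [complexGaussian, complexGaussian, Measure.map_map (by fun_prop) (by fun_prop)]
  congr 1
  funext z
  simp only [Function.comp_apply, zero_add, ← mul_assoc, hgain]

lemma map_sampleLaw_eq_channelLaw (hρ : 0 ≤ ρ) (hE : 0 ≤ E) :
    sampleLaw.map (fun ω => (dataSymbol ω, dataObs ρ ω, mmseGain E * trainObs E ω))
      = channelLaw ρ (1 / (1 + E)) (complexGaussian 0 (E / (1 + E))) := by
  have hs : 0 ≤ 1 / (1 + E) := by positivity
  have hmeas : ∀ f : ℂ × ℂ × ℂ → ENNReal, Measurable f → Measurable fun c => ∫⁻ x, ∫⁻ y,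
      f (x, y, c) ∂complexGaussian ((Real.sqrt ρ : ℂ) * c * x) (1 + ρ * (1 / (1 + E)) * ‖x‖ ^ 2)
      ∂stdCN := by
    intro f hf
    simp_rw [fun c x => lintegral_complexGaussian ((Real.sqrt ρ : ℂ) * c * x)
      (1 + ρ * (1 / (1 + E)) * ‖x‖ ^ 2) (show Measurable fun y => f (x, y, c) by fun_prop)]
    fun_prop
  refine Measure.ext_of_lintegral _ fun f hf => ?_
  rw [lintegral_map hf (by fun_prop), lintegral_sampleLaw (by fun_prop),
    lintegral_channelLaw hρ hs hf, ← map_mmseGain_mul_complexGaussian hE,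
    lintegral_map (hmeas f hf) (by fun_prop)]
  simp only [dataSymbol, dataObs, trainObs]
  rw [lintegral_fading_trainObs hE (f := fun q => ∫⁻ x, ∫⁻ w,
    f (x, (Real.sqrt ρ : ℂ) * q.1 * x + w, mmseGain E * q.2) ∂stdCN ∂stdCN) (by fun_prop)]
  refine lintegral_congr fun y => ?_
  rw [lintegral_lintegral_swap (by fun_prop)]
  refine lintegral_congr fun x => ?_
  have hconv := lintegral_complexGaussian_complexGaussian_mul ((Real.sqrt ρ : ℂ) * x)
    (mmseGain E * y) hs one_pos (f := fun z => f (x, z, mmseGain E * y)) (by fun_prop)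
  rw [norm_sqrt_mul_sq hρ, mul_right_comm ρ, mul_right_comm _ x] at hconv
  rw [← hconv]
  refine lintegral_congr fun h => ?_
  rw [lintegral_complexGaussian _ _ (by fun_prop)]
  simp only [Real.sqrt_one, Complex.ofReal_one, one_mul, mul_right_comm _ x]

lemma measurable_mmseEstimate (E : ℝ) : Measurable (mmseEstimate E) :=
  (stronglyMeasurable_condExp.mono (measurable_trainObs E).comap_le).measurable

lemma mutualInfo_eq_klDiv_channelLaw (hρ : 0 ≤ ρ) (hE : 0 ≤ E) {P : Measure (ℂ × ℂ × ℂ)}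
    (hP : P = channelLaw ρ (1 / (1 + E)) (complexGaussian 0 (E / (1 + E)))) :
    mutualInfo sampleLaw dataSymbol (fun ω => (dataObs ρ ω, mmseEstimate E ω))
      = InformationTheory.klDiv P (P.fst.prod P.snd) := by
  have hm := measurable_mmseEstimate E
  have hmap : sampleLaw.map (fun ω => (dataSymbol ω, dataObs ρ ω, mmseEstimate E ω)) = P := by
    rw [hP, ← map_sampleLaw_eq_channelLaw hρ hE]
    refine Measure.map_congr ?_
    filter_upwards [mmseEstimate_ae_eq hE] with ω hω
    rw [hω]
  rw [mutualInfo, ← Measure.fst_map_prodMk (X := dataSymbol)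
      (Y := fun ω => (dataObs ρ ω, mmseEstimate E ω)) (by fun_prop),
    ← Measure.snd_map_prodMk (X := dataSymbol)
      (Y := fun ω => (dataObs ρ ω, mmseEstimate E ω)) (by fun_prop), hmap]

lemma sub_sq_div_two_le_log_one_add {t : ℝ} (ht : 0 ≤ t) :
    t - t ^ 2 / 2 ≤ Real.log (1 + t) := by
  refine le_trans ?_ (Real.le_log_one_add_of_nonneg ht)
  rw [le_div_iff₀ (by positivity)]
  nlinarith [pow_nonneg ht 3]

lemma log_one_add_le_cubic {t : ℝ} (ht : 0 ≤ t) :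
    Real.log (1 + t) ≤ t - t ^ 2 / 2 + t ^ 3 / 3 := by
  have hderiv : ∀ x ∈ Set.Ici (0 : ℝ), HasDerivAt
      (fun x : ℝ => x - x ^ 2 / 2 + x ^ 3 / 3 - Real.log (1 + x)) (x ^ 3 / (1 + x)) x := by
    intro x (hx : 0 ≤ x)
    have h := (((hasDerivAt_id x).sub ((hasDerivAt_pow 2 x).div_const 2)).add
      ((hasDerivAt_pow 3 x).div_const 3)).sub
        (((hasDerivAt_id x).const_add 1).log (show 1 + x ≠ 0 by positivity))
    convert! h using 1
    simp only [id]
    field_simp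
    ring
  have hmono : MonotoneOn (fun x : ℝ => x - x ^ 2 / 2 + x ^ 3 / 3 - Real.log (1 + x))
      (Set.Ici 0) := by
    refine monotoneOn_of_hasDerivWithinAt_nonneg (convex_Ici 0)
      (fun x hx => (hderiv x hx).continuousAt.continuousWithinAt)
      (fun x hx => (hderiv x (interior_subset hx)).hasDerivWithinAt) fun x hx => ?_
    have : 0 ≤ x := interior_subset hx
    positivity
  have h := hmono Set.self_mem_Ici (Set.mem_Ici.2 ht) ht
  norm_num at h
  linarith

lemma integral_cubic_norm_sq_complexGaussian {v : ℝ} (hv : 0 ≤ v) (a b c d : ℝ) :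
    Integrable (fun z : ℂ => a + b * ‖z‖ ^ 2 + c * (‖z‖ ^ 2) ^ 2 + d * (‖z‖ ^ 2) ^ 3)
        (complexGaussian 0 v) ∧
      ∫ z, (a + b * ‖z‖ ^ 2 + c * (‖z‖ ^ 2) ^ 2 + d * (‖z‖ ^ 2) ^ 3) ∂complexGaussian 0 v
        = a + b * v + 2 * c * v ^ 2 + 6 * d * v ^ 3 := by
  have h1 := integrable_norm_sq_pow_complexGaussian hv 1
  have h2 := integrable_norm_sq_pow_complexGaussian hv 2
  have h3 := integrable_norm_sq_pow_complexGaussian hv 3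
  have hmean := integral_norm_sq_pow_complexGaussian hv 1
  simp only [pow_one] at h1 hmean
  refine ⟨by fun_prop, ?_⟩
  rw [integral_add (by fun_prop) (by fun_prop), integral_add (by fun_prop) (by fun_prop),
    integral_add (by fun_prop) (by fun_prop), integral_const_mul, integral_const_mul,
    integral_const_mul, hmean, integral_norm_sq_pow_complexGaussian hv,
    integral_norm_sq_pow_complexGaussian hv, integral_const, probReal_univ, one_smul]
  norm_num [Nat.factorial]
  ring

variable {s v : ℝ}

lemma le_integral_log_complexGaussian (hρ : 0 ≤ ρ) (hs : 0 ≤ s) (hv : 0 ≤ v) :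
    ρ * (s + v) - ρ ^ 2 * (s ^ 2 + 2 * s * v + 2 * v ^ 2) / 2
      ≤ ∫ z, Real.log (1 + ρ * (s + ‖z‖ ^ 2)) ∂complexGaussian 0 v := by
  obtain ⟨hint, heval⟩ := integral_cubic_norm_sq_complexGaussian hv
    (ρ * s - ρ ^ 2 * s ^ 2 / 2) (ρ - ρ ^ 2 * s) (-ρ ^ 2 / 2) 0
  have hlog := integrable_log_one_add_mul_norm_sq
    (by simpa using integrable_norm_sq_pow_complexGaussian hv 1) hρ hs
  calc _ = _ := by rw [heval]; ring
    _ ≤ _ := integral_mono hint hlog fun z => le_of_eq_of_le (by ring)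
        (sub_sq_div_two_le_log_one_add (t := ρ * (s + ‖z‖ ^ 2)) (by positivity))

lemma integral_log_complexGaussian_le (hρ : 0 ≤ ρ) (hs : 0 ≤ s) (hv : 0 ≤ v) :
    ∫ z, Real.log (1 + ρ * (s + ‖z‖ ^ 2)) ∂complexGaussian 0 v
      ≤ ρ * (s + v) - ρ ^ 2 * (s ^ 2 + 2 * s * v + 2 * v ^ 2) / 2
        + ρ ^ 3 * (s ^ 3 + 3 * s ^ 2 * v + 6 * s * v ^ 2 + 6 * v ^ 3) / 3 := by
  obtain ⟨hint, heval⟩ := integral_cubic_norm_sq_complexGaussian hv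
    (ρ * s - ρ ^ 2 * s ^ 2 / 2 + ρ ^ 3 * s ^ 3 / 3) (ρ - ρ ^ 2 * s + ρ ^ 3 * s ^ 2)
    (-ρ ^ 2 / 2 + ρ ^ 3 * s) (ρ ^ 3 / 3)
  have hlog := integrable_log_one_add_mul_norm_sq
    (by simpa using integrable_norm_sq_pow_complexGaussian hv 1) hρ hs
  calc _ ≤ _ := integral_mono hlog hint fun z => le_of_le_of_eq
        (log_one_add_le_cubic (t := ρ * (s + ‖z‖ ^ 2)) (by positivity)) (by ring)
    _ = _ := by rw [heval]; ring

lemma mutualInfo_mem_Icc (hρ : 0 ≤ ρ) (hE : 0 ≤ E) :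
    (mutualInfo sampleLaw dataSymbol (fun ω => (dataObs ρ ω, mmseEstimate E ω))).toReal
      ∈ Set.Icc (ρ * (E / (1 + E)) - ρ ^ 2)
        (ρ * (E / (1 + E)) - ρ ^ 2 * (1 - 3 / 2 * (1 / (1 + E))) + 2 * ρ ^ 3) := by
  have hv : 0 ≤ E / (1 + E) := by positivity
  have hs : 0 ≤ 1 / (1 + E) := by positivity
  have hsv : E / (1 + E) = 1 - 1 / (1 + E) := by field_simp; ring
  have hbounds := klDiv_channelLaw_bounds (τ := complexGaussian 0 (E / (1 + E))) hρ hs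
    (by simpa using integrable_norm_sq_pow_complexGaussian hv 1)
  rw [← mutualInfo_eq_klDiv_channelLaw hρ hE rfl] at hbounds
  have hrl := le_integral_log_complexGaussian hρ hs hv
  have hru := integral_log_complexGaussian_le hρ hs hv
  have hf := Real.log_le_sub_one_of_pos (show 0 < 1 + ρ * (1 / (1 + E)) by positivity)
  have hp := le_integral_log_complexGaussian (mul_nonneg hρ hs) le_rfl zero_le_one
  rw [complexGaussian_zero_one] at hp
  simp only [zero_add] at hp
  rw [hsv] at hv hbounds hrl hru ⊢
  generalize 1 / (1 + E) = s at *
  have hssq : s ^ 2 ≤ s := by nlinarith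
  have hcubic : s ^ 3 + 3 * s ^ 2 * (1 - s) + 6 * s * (1 - s) ^ 2 + 6 * (1 - s) ^ 3 ≤ 6 := by
    nlinarith [mul_nonneg hs hv, mul_nonneg (mul_nonneg hs hs) hv,
      mul_nonneg (mul_nonneg hs hv) hv, pow_nonneg hs 3]
  have hquad := mul_le_mul_of_nonneg_left hssq (sq_nonneg ρ)
  have hcube := mul_le_mul_of_nonneg_left hcubic (pow_nonneg hρ 3)
  constructor
  · nlinarith [hbounds.1, mul_nonneg (sq_nonneg ρ) hs]
  · nlinarith [hbounds.2]

end DataInformation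

section TrainingRate

variable {Nc snr η : ℝ}

lemma log_two_mul_trainingRate (Nc snr η : ℝ) : Real.log 2 * trainingRate Nc snr η
    = (Nc - 1) / Nc * (mutualInfo sampleLaw dataSymbol
        (fun ω => (dataObs ((1 - η) * Nc * snr / (Nc - 1)) ω,
          mmseEstimate (η * Nc * snr) ω))).toReal := by
  have : Real.log 2 ≠ 0 := (Real.log_pos (by norm_num)).ne'
  unfold trainingRate
  field_simp

lemma trainingRate_nonneg (hN : 1 ≤ Nc) : 0 ≤ trainingRate Nc snr η := by
  have : 0 ≤ Nc - 1 := by linarith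
  have : 0 ≤ Real.log 2 := Real.log_nonneg (by norm_num)
  unfold trainingRate
  positivity

lemma le_log_two_mul_trainingRate (hN : 1 < Nc) (hsnr : 0 ≤ snr) (hη : η ∈ Set.Icc (0 : ℝ) 1) :
    snr * ((1 - η) * (η * Nc * snr / (1 + η * Nc * snr))) - Nc / (Nc - 1) * ((1 - η) * snr) ^ 2
      ≤ Real.log 2 * trainingRate Nc snr η := by
  obtain ⟨hη0, hη1⟩ := hη
  have hN1 : 0 < Nc - 1 := by linarith
  have : 0 < Nc := by linarith
  have : 0 ≤ 1 - η := by linarith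
  have hI := (mutualInfo_mem_Icc (ρ := (1 - η) * Nc * snr / (Nc - 1)) (E := η * Nc * snr)
    (by positivity) (by positivity)).1
  rw [log_two_mul_trainingRate]
  refine le_of_eq_of_le ?_
    (mul_le_mul_of_nonneg_left hI (show 0 ≤ (Nc - 1) / Nc by positivity))
  field_simp

-- `ρ` is the energy per data symbol, `g` the proportion of data dimensions and `v` the variance of
-- the channel estimate. Both `η` and `1 - v` are at most the loss `1 - (1 - η) * v`, so half of the
-- first-order loss pays for the second-order gains from having `η` and `1 - v` positive.
lemma mul_information_bound_le {g ρ v : ℝ} (hsnr : 0 ≤ snr) (hsnr1 : snr ≤ 1 / 10)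
    (hη : η ∈ Set.Icc (0 : ℝ) 1) (hv : v ∈ Set.Icc (0 : ℝ) 1) (hg : g ∈ Set.Icc (1 / 2 : ℝ) 1)
    (hρ : 0 ≤ ρ) (hd : g * ρ = (1 - η) * snr) :
    g * (ρ * v - ρ ^ 2 * (1 - 3 / 2 * (1 - v)) + 2 * ρ ^ 3)
      ≤ snr - snr ^ 2 - snr / 2 * (1 - (1 - η) * v) + 8 * snr ^ 3 := by
  obtain ⟨hη0, hη1⟩ := hη
  obtain ⟨hv0, hv1⟩ := hv
  obtain ⟨hg2, hg1⟩ := hg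
  have hηL : η ≤ 1 - (1 - η) * v := by nlinarith
  have hvL : 1 - v ≤ 1 - (1 - η) * v := by nlinarith
  have hdρ : (1 - η) * snr ≤ ρ := hd ▸ mul_le_of_le_one_left hρ hg1
  have hd0 : 0 ≤ (1 - η) * snr := mul_nonneg (sub_nonneg.2 hη1) hsnr
  have hdsnr : (1 - η) * snr ≤ snr := mul_le_of_le_one_left hsnr (by linarith)
  have hρsnr : ρ ≤ 2 * snr := by nlinarith
  have hsq_ge : snr ^ 2 - 2 * (η * snr ^ 2) ≤ (1 - η) * snr * ρ := by
    nlinarith [mul_le_mul_of_nonneg_left hdρ hd0, mul_nonneg (sq_nonneg η) (sq_nonneg snr)]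
  have hsq_le : (1 - v) * ((1 - η) * snr * ρ) ≤ (1 - v) * (snr * (2 * snr)) := by
    have := sub_nonneg.2 hv1
    gcongr
  have hcube : (1 - η) * snr * ρ ^ 2 ≤ snr * (2 * snr) ^ 2 := by gcongr
  have hηsq := mul_le_mul_of_nonneg_right hηL (sq_nonneg snr)
  have hvsq := mul_le_mul_of_nonneg_right hvL (sq_nonneg snr)
  have hloss : (1 - (1 - η) * v) * snr * snr ≤ (1 - (1 - η) * v) * snr * (1 / 10) :=
    mul_le_mul_of_nonneg_left hsnr1 (mul_nonneg (hη0.trans hηL) hsnr)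
  calc g * (ρ * v - ρ ^ 2 * (1 - 3 / 2 * (1 - v)) + 2 * ρ ^ 3)
      = (1 - η) * snr * v - (1 - η) * snr * ρ + 3 / 2 * ((1 - v) * ((1 - η) * snr * ρ))
        + 2 * ((1 - η) * snr * ρ ^ 2) := by rw [← hd]; ring
    _ ≤ _ := by linarith

lemma log_two_mul_trainingRate_le (hN : 2 ≤ Nc) (hsnr : 0 ≤ snr) (hsnr1 : snr ≤ 1 / 10)
    (hη : η ∈ Set.Icc (0 : ℝ) 1) :
    Real.log 2 * trainingRate Nc snr η
      ≤ snr - snr ^ 2 - snr / 2 * (1 - (1 - η) * (η * Nc * snr / (1 + η * Nc * snr)))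
        + 8 * snr ^ 3 := by
  obtain ⟨hη0, hη1⟩ := hη
  have hN0 : 0 < Nc := by linarith
  have hN1 : 0 < Nc - 1 := by linarith
  have : 0 ≤ 1 - η := by linarith
  have hE : 0 ≤ η * Nc * snr := by positivity
  have hρ : 0 ≤ (1 - η) * Nc * snr / (Nc - 1) := by positivity
  have hv1 : η * Nc * snr / (1 + η * Nc * snr) ≤ 1 := by
    rw [div_le_one (by positivity)]; linarith
  have hs : 1 / (1 + η * Nc * snr) = 1 - η * Nc * snr / (1 + η * Nc * snr) := by field_simp; ring
  have hg1 : (Nc - 1) / Nc ≤ 1 := by rw [div_le_one hN0]; linarith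
  have hg2 : 1 / 2 ≤ (Nc - 1) / Nc := by rw [div_le_div_iff₀ two_pos hN0]; linarith
  have hI := (mutualInfo_mem_Icc hρ hE).2
  rw [hs] at hI
  rw [log_two_mul_trainingRate]
  exact (mul_le_mul_of_nonneg_left hI (by positivity)).trans <|
    mul_information_bound_le hsnr hsnr1 ⟨hη0, hη1⟩ ⟨by positivity, hv1⟩ ⟨hg2, hg1⟩ hρ
      (by field_simp)

lemma one_sub_mul_training_le {A : ℝ} (hA : 0 ≤ A) (hη : η ∈ Set.Icc (0 : ℝ) 1) :
    (1 - η) * (η * A / (1 + η * A)) ≤ 1 - 1 / (1 + Real.sqrt A) := by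
  obtain ⟨hη0, hη1⟩ := hη
  have hsq := Real.mul_self_sqrt hA
  have ht := Real.sqrt_nonneg A
  set t := Real.sqrt A
  have hv : η * A / (1 + η * A) = 1 - 1 / (1 + η * A) := by
    have : 0 < 1 + η * A := by positivity
    field_simp
    ring
  have hv1 : 0 < 1 / (1 + η * A) := by positivity
  have hv0 : 0 ≤ η * A / (1 + η * A) := by positivity
  obtain h | h := le_or_gt (η * t) 1
  · have hest : 1 / (1 + t) ≤ 1 / (1 + η * A) :=
      one_div_le_one_div_of_le (by positivity) (by nlinarith)
    nlinarith
  · have htrain : 1 / (1 + t) ≤ η := by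
      rw [div_le_iff₀ (by positivity)]
      nlinarith
    nlinarith

/-- The training rate for the best split of the energy, for an arbitrary coherence dimension. -/
noncomputable def optimalRate (Nc snr : ℝ) : ℝ := ⨆ η : Set.Icc (0 : ℝ) 1, trainingRate Nc snr η

lemma log_two_mul_trainingRate_le_of_mem_Icc (hN : 2 ≤ Nc) (hsnr : 0 ≤ snr) (hsnr1 : snr ≤ 1 / 10)
    (hη : η ∈ Set.Icc (0 : ℝ) 1) :
    Real.log 2 * trainingRate Nc snr η
      ≤ snr - snr ^ 2 - snr / (2 * (1 + Real.sqrt (Nc * snr))) + 8 * snr ^ 3 := by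
  have hloss := mul_le_mul_of_nonneg_left
    (one_sub_mul_training_le (A := Nc * snr) (by positivity) hη) hsnr
  rw [← mul_assoc η] at hloss
  have hsplit : snr / (2 * (1 + Real.sqrt (Nc * snr)))
      = snr / 2 * (1 / (1 + Real.sqrt (Nc * snr))) := by field_simp
  linarith [log_two_mul_trainingRate_le hN hsnr hsnr1 hη]

lemma log_two_mul_optimalRate_le (hN : 2 ≤ Nc) (hsnr : 0 ≤ snr) (hsnr1 : snr ≤ 1 / 10) :
    Real.log 2 * optimalRate Nc snr
      ≤ snr - snr ^ 2 - snr / (2 * (1 + Real.sqrt (Nc * snr))) + 8 * snr ^ 3 := by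
  rw [optimalRate, Real.mul_iSup_of_nonneg (Real.log_nonneg (by norm_num))]
  exact ciSup_le fun η => log_two_mul_trainingRate_le_of_mem_Icc hN hsnr hsnr1 η.2

lemma log_two_mul_trainingRate_le_optimalRate (hN : 2 ≤ Nc) (hsnr : 0 ≤ snr)
    (hsnr1 : snr ≤ 1 / 10) (hη : η ∈ Set.Icc (0 : ℝ) 1) :
    Real.log 2 * trainingRate Nc snr η ≤ Real.log 2 * optimalRate Nc snr := by
  rw [optimalRate, Real.mul_iSup_of_nonneg (Real.log_nonneg (by norm_num))]
  refine le_ciSup (f := fun η : Set.Icc (0 : ℝ) 1 => Real.log 2 * trainingRate Nc snr η)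
    ⟨snr - snr ^ 2 - snr / (2 * (1 + Real.sqrt (Nc * snr))) + 8 * snr ^ 3, ?_⟩ ⟨η, hη⟩
  rintro _ ⟨η, rfl⟩
  exact log_two_mul_trainingRate_le_of_mem_Icc hN hsnr hsnr1 η.2

lemma div_sub_one_le_one_add_two_div (hN : 2 ≤ Nc) : Nc / (Nc - 1) ≤ 1 + 2 / Nc := by
  rw [div_le_iff₀ (by linarith)]
  field_simp
  nlinarith

-- The training fraction `1 / √(Nc * snr)` balances the energy spent on training against the
-- estimation error.
lemma le_log_two_mul_optimalRate_of_one_le (hN : 2 ≤ Nc) (hsnr : 0 < snr) (hsnr1 : snr ≤ 1 / 10)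
    (hA : 1 ≤ Nc * snr) :
    snr - snr ^ 2 - 4 * (snr / Real.sqrt (Nc * snr)) ≤ Real.log 2 * optimalRate Nc snr := by
  have ht : 1 ≤ Real.sqrt (Nc * snr) := Real.one_le_sqrt.2 hA
  have hsq := Real.mul_self_sqrt (zero_le_one.trans hA)
  set t := Real.sqrt (Nc * snr)
  have ht0 : 0 < t := by linarith
  have hη0 : 0 < 1 / t := by positivity
  have hη1 : 1 / t ≤ 1 := by rwa [div_le_one ht0]
  have hE : 1 / t * Nc * snr = t := by field_simp; linarith
  have hloss : 1 - 2 * (1 / t) ≤ (1 - 1 / t) * (t / (1 + t)) := by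
    have : (1 - 1 / t) * (t / (1 + t)) = 1 - 2 * (1 / (1 + t)) := by field_simp; ring
    have := one_div_le_one_div_of_le ht0 (show t ≤ 1 + t by linarith)
    linarith
  have hdim : Nc / (Nc - 1) * snr ^ 2 ≤ snr ^ 2 + 2 * (snr / t) := by
    have hsmall : snr ^ 2 / Nc ≤ snr / t := by
      rw [div_le_div_iff₀ (by linarith) ht0, mul_comm snr, ← hsq]
      gcongr
      nlinarith
    calc Nc / (Nc - 1) * snr ^ 2 ≤ (1 + 2 / Nc) * snr ^ 2 := by
          gcongr; exact div_sub_one_le_one_add_two_div hN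
      _ = snr ^ 2 + 2 * (snr ^ 2 / Nc) := by ring
      _ ≤ _ := by gcongr
  have hdata : Nc / (Nc - 1) * ((1 - 1 / t) * snr) ^ 2 ≤ Nc / (Nc - 1) * snr ^ 2 := by
    have : 0 ≤ Nc / (Nc - 1) := div_nonneg (by linarith) (by linarith)
    have : 0 ≤ 1 - 1 / t := by linarith
    gcongr
    exact mul_le_of_le_one_left hsnr.le (by linarith)
  have hrate := (le_log_two_mul_trainingRate (by linarith) hsnr.le ⟨hη0.le, hη1⟩).trans
    (log_two_mul_trainingRate_le_optimalRate hN hsnr.le hsnr1 ⟨hη0.le, hη1⟩)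
  rw [hE] at hrate
  have hmain := mul_le_mul_of_nonneg_left hloss hsnr.le
  have : snr * (1 - 2 * (1 / t)) = snr - 2 * (snr / t) := by ring
  linarith

lemma le_log_two_mul_optimalRate (hN : 2 ≤ Nc) (hsnr : 0 < snr) (hsnr1 : snr ≤ 1 / 10) :
    snr - snr ^ 2 - 4 * (snr / Real.sqrt (Nc * snr)) ≤ Real.log 2 * optimalRate Nc snr := by
  obtain h | h := le_or_gt 1 (Nc * snr)
  · exact le_log_two_mul_optimalRate_of_one_le hN hsnr hsnr1 h
  · have ht := Real.sqrt_pos.2 (show 0 < Nc * snr by positivity)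
    have hnonneg : 0 ≤ optimalRate Nc snr :=
      Real.iSup_nonneg fun _ => trainingRate_nonneg (by linarith)
    have hlarge : snr ≤ snr / Real.sqrt (Nc * snr) :=
      le_div_self hsnr.le ht (Real.sqrt_le_one.2 h.le)
    have := mul_nonneg (Real.log_nonneg one_le_two) hnonneg
    nlinarith

end TrainingRate

section WidebandRegime

variable {R : ℝ → ℝ} {b c e x S : ℝ}

lemma tendsto_id_nhdsGT_zero : Tendsto (fun x : ℝ => x) (𝓝[>] 0) (𝓝 0) :=
  tendsto_id.mono_left nhdsWithin_le_nhds

lemma tendsto_rpow_nhdsGT_zero {p : ℝ} (hp : 0 < p) :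
    Tendsto (fun x : ℝ => x ^ p) (𝓝[>] 0) (𝓝 0) := by
  have h := (Real.continuousAt_rpow_const 0 p (Or.inr hp.le)).tendsto
  rw [Real.zero_rpow hp.ne'] at h
  exact h.mono_left nhdsWithin_le_nhds

lemma hasEbN0_iff_tendsto (he : e ≠ 0) :
    HasEbN0 R e ↔ Tendsto (fun x => e * R x / x) (𝓝[>] 0) (𝓝 1) := by
  have hinv : (fun x => e * R x / x) = fun x => (e⁻¹ * (x / R x))⁻¹ := by
    ext x
    rw [mul_inv, inv_inv, inv_div, mul_div_assoc]
  rw [HasEbN0, hinv, ← inv_one, tendsto_inv_iff₀ one_ne_zero, ← inv_mul_cancel₀ he]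
  exact (tendsto_const_smul_iff₀ (inv_ne_zero he)).symm

lemma tendsto_of_tendsto_sub_one_div {m : ℝ → ℝ}
    (h : Tendsto (fun x => (m x - 1) / x) (𝓝[>] 0) (𝓝 c)) : Tendsto m (𝓝[>] 0) (𝓝 1) := by
  have hm := (h.mul tendsto_id_nhdsGT_zero).add_const 1
  rw [mul_zero, zero_add] at hm
  refine hm.congr' ?_
  filter_upwards [self_mem_nhdsWithin] with x hx
  rw [div_mul_cancel₀ _ (ne_of_gt hx), sub_add_cancel]

lemma tendsto_log_div {m : ℝ → ℝ} (h : Tendsto (fun x => (m x - 1) / x) (𝓝[>] 0) (𝓝 c)) :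
    Tendsto (fun x => Real.log (m x) / x) (𝓝[>] 0) (𝓝 c) := by
  have hm := tendsto_of_tendsto_sub_one_div h
  have hlow := h.div hm one_ne_zero
  rw [div_one] at hlow
  refine tendsto_of_tendsto_of_tendsto_of_le_of_le' hlow h ?_ ?_ <;>
    filter_upwards [hm.eventually_const_lt one_pos, self_mem_nhdsWithin] with x hmx hx
  · have hlog := Real.one_sub_inv_le_log_of_pos hmx
    rw [Pi.div_apply, div_right_comm, sub_div, div_self hmx.ne', one_div]
    exact div_le_div_of_nonneg_right hlog (le_of_lt hx)
  · exact div_le_div_of_nonneg_right (Real.log_le_sub_one_of_pos hmx) (le_of_lt hx)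

lemma slope_decibel_eq {r : ℝ} (he : 0 < e) (hx : 0 < x) (hr : 0 < r) :
    r / (10 * Real.logb 10 (x / r) - 10 * Real.logb 10 e) * (10 * Real.logb 10 2)
      = r * Real.log 2 / -Real.log (e * r / x) := by
  have hlog10 : Real.log 10 ≠ 0 := (Real.log_pos (by norm_num)).ne'
  have hlog : -Real.log (e * r / x) = Real.log (x / r) - Real.log e := by
    rw [Real.log_div (by positivity) hx.ne', Real.log_div hx.ne' hr.ne',
      Real.log_mul he.ne' hr.ne']
    ring
  have hdecibel : 10 * Real.logb 10 (x / r) - 10 * Real.logb 10 e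
      = (Real.log (x / r) - Real.log e) * (10 / Real.log 10) := by
    unfold Real.logb
    ring
  rw [hlog, hdecibel, Real.logb, ← div_div, div_mul_eq_mul_div, div_div_eq_mul_div]
  field_simp

lemma hasEbN0_of_tendsto (he : e ≠ 0)
    (h : Tendsto (fun x => (e * R x / x - 1) / x) (𝓝[>] 0) (𝓝 (-b))) : HasEbN0 R e :=
  (hasEbN0_iff_tendsto he).2 (tendsto_of_tendsto_sub_one_div h)

lemma eventually_pos_of_tendsto (he : 0 < e)
    (h : Tendsto (fun x => e * R x / x) (𝓝[>] 0) (𝓝 1)) : ∀ᶠ x in 𝓝[>] 0, 0 < x ∧ 0 < R x := by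
  filter_upwards [h.eventually_const_lt one_pos, self_mem_nhdsWithin] with x hm hx
  have hmx := mul_pos hm hx
  rw [div_mul_cancel₀ _ (ne_of_gt hx)] at hmx
  exact ⟨hx, pos_of_mul_pos_right hmx he.le⟩

lemma hasWidebandSlope_of_tendsto (he : 0 < e) (hb : b ≠ 0)
    (h : Tendsto (fun x => (e * R x / x - 1) / x) (𝓝[>] 0) (𝓝 (-b))) :
    HasWidebandSlope R e (Real.log 2 / (e * b)) := by
  have hm := tendsto_of_tendsto_sub_one_div h
  have hslope := (hm.const_mul (Real.log 2 / e)).div (tendsto_log_div h).neg (by simpa using hb)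
  rw [neg_neg, mul_one, div_div] at hslope
  refine hslope.congr' ?_
  filter_upwards [eventually_pos_of_tendsto he hm] with x hx
  have := hx.1.ne'
  rw [Pi.div_apply, slope_decibel_eq he hx.1 hx.2, ← neg_div]
  field_simp

lemma le_of_hasWidebandSlope (he : 0 < e) (hb : 0 < b) (hE : HasEbN0 R e)
    (hS : HasWidebandSlope R e S) (h : ∀ᶠ x in 𝓝[>] 0, e * R x ≤ x - b * x ^ 2) :
    S ≤ Real.log 2 / (e * b) := by
  refine le_of_tendsto hS ?_
  filter_upwards [h, eventually_pos_of_tendsto he ((hasEbN0_iff_tendsto he.ne').1 hE)]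
    with x hRx ⟨hx, hR⟩
  rw [slope_decibel_eq he hx hR]
  have hlog : b * x ≤ -Real.log (e * R x / x) := by
    have hm : e * R x / x ≤ 1 - b * x := by
      rw [div_le_iff₀ hx]
      linarith
    have := Real.log_le_sub_one_of_pos (show 0 < e * R x / x by positivity)
    linarith
  have hR' : R x ≤ x / e := by
    rw [le_div_iff₀' he]
    nlinarith [sq_nonneg x]
  have : 0 ≤ Real.log 2 := Real.log_nonneg one_le_two
  calc R x * Real.log 2 / -Real.log (e * R x / x) ≤ x / e * Real.log 2 / (b * x) := by gcongr
    _ = Real.log 2 / (e * b) := by field_simp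

lemma one_le_of_hasEbN0 (he : e ≠ 0) (hE : HasEbN0 R e)
    (h : ∀ᶠ x in 𝓝[>] 0, e * R x ≤ c * x) : 1 ≤ c := by
  refine le_of_tendsto ((hasEbN0_iff_tendsto he).1 hE) ?_
  filter_upwards [h, self_mem_nhdsWithin] with x hRx hx
  rwa [div_le_iff₀ hx]

lemma hasEbN0_of_mem_Icc {κ : ℝ} (he : e ≠ 0) (hκ : 1 < κ)
    (h : ∀ᶠ x in 𝓝[>] 0, e * R x ∈ Set.Icc (x - b * x ^ 2 - c * x ^ κ) x) : HasEbN0 R e := by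
  have hlow : Tendsto (fun x : ℝ => 1 - b * x - c * x ^ (κ - 1)) (𝓝[>] 0) (𝓝 1) := by
    simpa using ((tendsto_id_nhdsGT_zero.const_mul b).const_sub 1).sub
      ((tendsto_rpow_nhdsGT_zero (sub_pos.2 hκ)).const_mul c)
  refine (hasEbN0_iff_tendsto he).2
    (tendsto_of_tendsto_of_tendsto_of_le_of_le' hlow tendsto_const_nhds ?_ ?_) <;>
    filter_upwards [h, self_mem_nhdsWithin] with x hRx (hx : 0 < x)
  · have hpow : x ^ κ = x ^ (κ - 1) * x := by
      rw [← Real.rpow_add_one hx.ne', sub_add_cancel]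
    have hlow := hRx.1
    rw [hpow] at hlow
    rw [le_div_iff₀ hx]
    linarith
  · exact (div_le_one hx).2 hRx.2

lemma tendsto_of_mem_Icc {κ c' : ℝ} (hκ : 2 < κ)
    (h : ∀ᶠ x in 𝓝[>] 0, e * R x ∈ Set.Icc (x - b * x ^ 2 - c * x ^ κ)
      (x - b * x ^ 2 + c' * x ^ 3)) :
    Tendsto (fun x => (e * R x / x - 1) / x) (𝓝[>] 0) (𝓝 (-b)) := by
  have hlow : Tendsto (fun x : ℝ => -b - c * x ^ (κ - 2)) (𝓝[>] 0) (𝓝 (-b)) := by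
    simpa using ((tendsto_rpow_nhdsGT_zero (sub_pos.2 hκ)).const_mul c).const_sub (-b)
  have hup : Tendsto (fun x : ℝ => -b + c' * x) (𝓝[>] 0) (𝓝 (-b)) := by
    simpa using (tendsto_id_nhdsGT_zero.const_mul c').const_add (-b)
  refine tendsto_of_tendsto_of_tendsto_of_le_of_le' hlow hup ?_ ?_ <;>
    filter_upwards [h, self_mem_nhdsWithin] with x hRx (hx : 0 < x)
  · have hpow : x ^ κ = x ^ (κ - 2) * x ^ 2 := by
      rw [← Real.rpow_two, ← Real.rpow_add hx, sub_add_cancel]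
    have hlow := hRx.1
    rw [hpow] at hlow
    rw [le_div_iff₀ hx, le_sub_iff_add_le, le_div_iff₀ hx]
    linarith
  · rw [div_le_iff₀ hx, sub_le_iff_le_add, div_le_iff₀ hx]
    linarith [hRx.2]

end WidebandRegime

section Optimality

variable {k μ snr e S : ℝ}

lemma log_two_mul_coherentCapacity (snr : ℝ) :
    Real.log 2 * coherentCapacity snr = ∫ h, Real.log (1 + snr * ‖h‖ ^ 2) ∂stdCN := by
  have : Real.log 2 ≠ 0 := (Real.log_pos one_lt_two).ne'
  simp only [coherentCapacity, Real.logb, integral_div]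
  field_simp

lemma log_two_mul_coherentCapacity_mem_Icc (hsnr : 0 ≤ snr) :
    Real.log 2 * coherentCapacity snr ∈ Set.Icc (snr - snr ^ 2) (snr - snr ^ 2 + 2 * snr ^ 3) := by
  have hlow := le_integral_log_complexGaussian hsnr le_rfl zero_le_one
  have hup := integral_log_complexGaussian_le hsnr le_rfl zero_le_one
  simp only [complexGaussian_zero_one, zero_add] at hlow hup
  rw [log_two_mul_coherentCapacity]
  constructor <;> linarith

lemma tendsto_coherentCapacity :
    Tendsto (fun x => (Real.log 2 * coherentCapacity x / x - 1) / x) (𝓝[>] 0) (𝓝 (-1)) := by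
  refine tendsto_of_mem_Icc (c := 0) (κ := 3) (c' := 2) (by norm_num) ?_
  filter_upwards [self_mem_nhdsWithin] with x (hx : 0 < x)
  simpa only [one_mul, zero_mul, sub_zero] using log_two_mul_coherentCapacity_mem_Icc hx.le

lemma hasEbN0_coherentCapacity : HasEbN0 coherentCapacity (Real.log 2) :=
  hasEbN0_of_tendsto (Real.log_pos one_lt_two).ne' tendsto_coherentCapacity

lemma hasWidebandSlope_coherentCapacity : HasWidebandSlope coherentCapacity (Real.log 2) 1 := by
  have hlog2 := Real.log_pos one_lt_two
  simpa only [mul_one, div_self hlog2.ne'] using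
    hasWidebandSlope_of_tendsto hlog2 one_ne_zero tendsto_coherentCapacity

lemma sqrt_coherence_energy (hk : 0 ≤ k) (hsnr : 0 < snr) :
    Real.sqrt (k / snr ^ μ * snr) = Real.sqrt k * snr ^ ((1 - μ) / 2) := by
  have hpow : k / snr ^ μ * snr = k * snr ^ (1 - μ) := by
    rw [Real.rpow_sub hsnr, Real.rpow_one]
    ring
  rw [hpow, Real.sqrt_mul hk, Real.sqrt_eq_rpow (snr ^ (1 - μ)), ← Real.rpow_mul hsnr.le,
    mul_one_div]

lemma eventually_two_le_coherence (hk : 0 < k) (hμ : 0 < μ) :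
    ∀ᶠ snr in 𝓝[>] 0, 2 ≤ k / snr ^ μ := by
  filter_upwards [(tendsto_rpow_nhdsGT_zero hμ).eventually_le_const (half_pos hk),
    self_mem_nhdsWithin] with x hx (hx0 : 0 < x)
  rw [le_div_iff₀ (Real.rpow_pos_of_pos hx0 _)]
  linarith

lemma eventually_le_nhdsGT_zero {c : ℝ} (hc : 0 < c) : ∀ᶠ x : ℝ in 𝓝[>] 0, x ≤ c :=
  tendsto_id_nhdsGT_zero.eventually_le_const hc

lemma eventually_le_log_two_mul_avgMutualInfo (hk : 0 < k) (hμ : 0 < μ) :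
    ∀ᶠ snr in 𝓝[>] 0, snr - snr ^ 2 - 4 / Real.sqrt k * snr ^ ((1 + μ) / 2)
      ≤ Real.log 2 * avgMutualInfo k μ snr := by
  filter_upwards [eventually_two_le_coherence hk hμ, self_mem_nhdsWithin,
    eventually_le_nhdsGT_zero (show (0 : ℝ) < 1 / 10 by norm_num)] with x hN (hx : 0 < x) hx1
  have hpow : x ^ ((1 + μ) / 2) = x / x ^ ((1 - μ) / 2) := by
    rw [eq_div_iff (Real.rpow_pos_of_pos hx _).ne', ← Real.rpow_add hx,
      show (1 + μ) / 2 + (1 - μ) / 2 = 1 by ring, Real.rpow_one]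
  have hloss : 4 / Real.sqrt k * x ^ ((1 + μ) / 2) = 4 * (x / Real.sqrt (k / x ^ μ * x)) := by
    rw [sqrt_coherence_energy hk.le hx, hpow, div_mul_div_comm, mul_div_assoc]
  rw [hloss]
  exact le_log_two_mul_optimalRate hN hx hx1

lemma eventually_log_two_mul_avgMutualInfo_le (hk : 0 < k) (hμ : 0 < μ) :
    ∀ᶠ snr in 𝓝[>] 0, Real.log 2 * avgMutualInfo k μ snr
      ≤ snr - snr ^ 2 - snr / (2 * (1 + Real.sqrt k * snr ^ ((1 - μ) / 2))) + 8 * snr ^ 3 := by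
  filter_upwards [eventually_two_le_coherence hk hμ, self_mem_nhdsWithin,
    eventually_le_nhdsGT_zero (show (0 : ℝ) < 1 / 10 by norm_num)] with x hN (hx : 0 < x) hx1
  rw [← sqrt_coherence_energy hk.le hx]
  exact log_two_mul_optimalRate_le hN hx.le hx1

lemma eventually_log_two_mul_avgMutualInfo_le_of_le_one (hk : 0 < k) (hμ : 0 < μ) (hμ1 : μ ≤ 1) :
    ∀ᶠ snr in 𝓝[>] 0, Real.log 2 * avgMutualInfo k μ snr
      ≤ (1 - 1 / (2 * (1 + Real.sqrt k))) * snr := by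
  filter_upwards [eventually_log_two_mul_avgMutualInfo_le hk hμ, self_mem_nhdsWithin,
    eventually_le_nhdsGT_zero (show (0 : ℝ) < 1 / 8 by norm_num)] with x hrate (hx : 0 < x) hx1
  have hpow : x ^ ((1 - μ) / 2) ≤ 1 := Real.rpow_le_one hx.le (by linarith) (by linarith)
  have hloss : x * (1 / (2 * (1 + Real.sqrt k)))
      ≤ x / (2 * (1 + Real.sqrt k * x ^ ((1 - μ) / 2))) := by
    rw [mul_one_div]
    gcongr
    exact mul_le_of_le_one_right (Real.sqrt_nonneg k) hpow
  have hcube : 8 * x ^ 3 ≤ x ^ 2 := by nlinarith [sq_nonneg x]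
  linarith

lemma eventually_log_two_mul_avgMutualInfo_le_of_le_three (hk : 0 < k) (hμ : 0 < μ)
    (hμ3 : μ ≤ 3) :
    ∀ᶠ snr in 𝓝[>] 0, Real.log 2 * avgMutualInfo k μ snr
      ≤ snr - (1 + 1 / (4 * (1 + Real.sqrt k))) * snr ^ 2 := by
  have hδ : 1 / (2 * (1 + Real.sqrt k)) = 2 * (1 / (4 * (1 + Real.sqrt k))) := by
    field_simp
    norm_num
  filter_upwards [eventually_log_two_mul_avgMutualInfo_le hk hμ, self_mem_nhdsWithin,
    eventually_le_nhdsGT_zero one_pos,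
    eventually_le_nhdsGT_zero (show 0 < 1 / (4 * (1 + Real.sqrt k)) / 8 by positivity)]
    with x hrate (hx : 0 < x) hx1 hxδ
  have hpow : x ^ ((1 - μ) / 2) * x ≤ 1 := by
    rw [← Real.rpow_add_one hx.ne']
    exact Real.rpow_le_one hx.le hx1 (by linarith)
  have hloss : 1 / (2 * (1 + Real.sqrt k)) * x ^ 2
      ≤ x / (2 * (1 + Real.sqrt k * x ^ ((1 - μ) / 2))) := by
    have hk0 := Real.sqrt_nonneg k
    have : 0 ≤ x ^ ((1 - μ) / 2) := Real.rpow_nonneg hx.le _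
    rw [one_div_mul_eq_div, div_le_div_iff₀ (by positivity) (by positivity)]
    nlinarith [mul_le_mul_of_nonneg_left hpow (mul_nonneg hk0 hx.le)]
  have hcube : 8 * x ^ 3 ≤ 1 / (4 * (1 + Real.sqrt k)) * x ^ 2 := by
    rw [le_div_iff₀ (by norm_num)] at hxδ
    nlinarith [mul_le_mul_of_nonneg_right hxδ (sq_nonneg x)]
  rw [hδ] at hloss
  linarith

lemma hasEbN0_avgMutualInfo (hk : 0 < k) (hμ : 1 < μ) :
    HasEbN0 (avgMutualInfo k μ) (Real.log 2) := by
  have hμ0 : 0 < μ := by linarith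
  refine hasEbN0_of_mem_Icc (b := 1) (c := 4 / Real.sqrt k) (κ := (1 + μ) / 2)
    (Real.log_pos one_lt_two).ne' (by linarith) ?_
  filter_upwards [eventually_le_log_two_mul_avgMutualInfo hk hμ0,
    eventually_log_two_mul_avgMutualInfo_le hk hμ0, self_mem_nhdsWithin,
    eventually_le_nhdsGT_zero (show (0 : ℝ) < 1 / 8 by norm_num)] with x hlow hup (hx : 0 < x) hx1
  have hcube : 8 * x ^ 3 ≤ x ^ 2 := by nlinarith [sq_nonneg x]
  have : 0 ≤ x / (2 * (1 + Real.sqrt k * x ^ ((1 - μ) / 2))) := by positivity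
  constructor <;> linarith

lemma firstOrderOptimal_avgMutualInfo_iff (hk : 0 < k) (hμ : 0 < μ) :
    FirstOrderOptimal coherentCapacity (avgMutualInfo k μ) ↔ 1 < μ := by
  refine ⟨?_, fun h => ⟨Real.log 2, hasEbN0_coherentCapacity, hasEbN0_avgMutualInfo hk h⟩⟩
  rintro ⟨e, hC, hR⟩
  obtain rfl := tendsto_nhds_unique hC hasEbN0_coherentCapacity
  by_contra! hμ1
  have := one_le_of_hasEbN0 (Real.log_pos one_lt_two).ne' hR
    (eventually_log_two_mul_avgMutualInfo_le_of_le_one hk hμ hμ1)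
  have : 0 < 1 / (2 * (1 + Real.sqrt k)) := by positivity
  linarith

lemma hasWidebandSlope_avgMutualInfo (hk : 0 < k) (hμ : 3 < μ) :
    HasWidebandSlope (avgMutualInfo k μ) (Real.log 2) 1 := by
  have hlog2 := Real.log_pos one_lt_two
  have hμ0 : 0 < μ := by linarith
  have hexpansion : ∀ᶠ x in 𝓝[>] 0, Real.log 2 * avgMutualInfo k μ x ∈ Set.Icc
      (x - 1 * x ^ 2 - 4 / Real.sqrt k * x ^ ((1 + μ) / 2)) (x - 1 * x ^ 2 + 8 * x ^ 3) := by
    filter_upwards [eventually_le_log_two_mul_avgMutualInfo hk hμ0,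
      eventually_log_two_mul_avgMutualInfo_le hk hμ0, self_mem_nhdsWithin]
      with x hlow hup (hx : 0 < x)
    have : 0 ≤ x / (2 * (1 + Real.sqrt k * x ^ ((1 - μ) / 2))) := by positivity
    constructor <;> linarith
  simpa only [mul_one, div_self hlog2.ne'] using
    hasWidebandSlope_of_tendsto hlog2 one_ne_zero (tendsto_of_mem_Icc (by linarith) hexpansion)

lemma secondOrderOptimal_avgMutualInfo_iff (hk : 0 < k) (hμ : 0 < μ) :
    SecondOrderOptimal coherentCapacity (avgMutualInfo k μ) ↔ 3 < μ := by
  refine ⟨?_, fun h => ⟨Real.log 2, 1, hasEbN0_coherentCapacity, hasEbN0_avgMutualInfo hk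
    (by linarith), hasWidebandSlope_coherentCapacity, hasWidebandSlope_avgMutualInfo hk h⟩⟩
  rintro ⟨e, S, hC, hR, hSC, hSR⟩
  obtain rfl := tendsto_nhds_unique hC hasEbN0_coherentCapacity
  obtain rfl := tendsto_nhds_unique hSC hasWidebandSlope_coherentCapacity
  by_contra! hμ3
  have hlog2 := Real.log_pos one_lt_two
  have hδ : 0 < 1 / (4 * (1 + Real.sqrt k)) := by positivity
  have hslope := le_of_hasWidebandSlope hlog2 (by positivity) hR hSR
    (eventually_log_two_mul_avgMutualInfo_le_of_le_three hk hμ hμ3)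
  rw [div_mul_cancel_left₀ hlog2.ne'] at hslope
  exact absurd hslope (not_le.2 (inv_lt_one_of_one_lt₀ (by linarith)))

lemma logb_two_exp_one_mul_le_iff {x y : ℝ} :
    Real.logb 2 (Real.exp 1) * x ≤ y ↔ x ≤ Real.log 2 * y := by
  rw [Real.logb, Real.log_exp, one_div_mul_eq_div, div_le_iff₀' (Real.log_pos one_lt_two)]

end Optimality

end TrainingSTF

theorem theorem1 (k μ : ℝ) (hk : 0 < k) (hμ : 0 < μ) :
    (∃ c : ℝ, ∀ᶠ snr : ℝ in 𝓝[>] 0,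
      Real.logb 2 (Real.exp 1) * (snr - snr ^ 2 - c * snr ^ ((1 + μ) / 2))
        ≤ TrainingSTF.avgMutualInfo k μ snr) ∧
    (μ ≤ 3 → ∃ c : ℝ, ∀ᶠ snr : ℝ in 𝓝[>] 0,
      Real.logb 2 (Real.exp 1) * (snr - c * snr ^ ((1 + μ) / 2))
        ≤ TrainingSTF.avgMutualInfo k μ snr) ∧
    (TrainingSTF.FirstOrderOptimal TrainingSTF.coherentCapacity
      (TrainingSTF.avgMutualInfo k μ) ↔ 1 < μ) ∧
    (TrainingSTF.SecondOrderOptimal TrainingSTF.coherentCapacity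
      (TrainingSTF.avgMutualInfo k μ) ↔ 3 < μ) := by
  refine ⟨⟨4 / Real.sqrt k, ?_⟩, fun hμ3 => ⟨1 + 4 / Real.sqrt k, ?_⟩,
    TrainingSTF.firstOrderOptimal_avgMutualInfo_iff hk hμ,
    TrainingSTF.secondOrderOptimal_avgMutualInfo_iff hk hμ⟩
  all_goals simp only [TrainingSTF.logb_two_exp_one_mul_le_iff]
  · exact TrainingSTF.eventually_le_log_two_mul_avgMutualInfo hk hμ
  · filter_upwards [TrainingSTF.eventually_le_log_two_mul_avgMutualInfo hk hμ,
      self_mem_nhdsWithin, TrainingSTF.eventually_le_nhdsGT_zero one_pos]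
      with snr hrate (hsnr : 0 < snr) hsnr1
    have hsq : snr ^ 2 ≤ snr ^ ((1 + μ) / 2) := by
      rw [← Real.rpow_two]
      exact Real.rpow_le_rpow_of_exponent_ge hsnr hsnr1 (by linarith)
    linarith
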